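/- Let $G$ be a finite-dimensional complex Lie group with identity $e$, holomorphic tangent spaces $T^{1,0}_gG$ and holomorphic Lie algebra $\mathfrak g=T^{1,0}_eG$, with the bracket of left-invariant holomorphic vector fields. Write $L_h$ for left translation by $h$. Equip $G$ with a left-invariant Hermitian metric, i.e. a Hermitian metric for which every $(dL_h)_g:T^{1,0}_gG\to T^{1,0}_{hg}G$ is an isometry, and put $$C_{\mathfrak g}:=\sup\{\|[X,Y]\| : X,Y\in\mathfrak g,\ \|X\|=\|Y\|=1\}$$ (with $C_{\mathfrak g}:=0$ if $\mathfrak g=0$). For $g\in G$ and $\xi\in T^{1,0}_gG$ let $\tilde\xi_h=(dL_h)_e(dL_{g^{-1}})_g(\xi)$, $h\in G$, be the left-invariant holomorphic vector field generated by $\xi$, and define $\exp_g:T^{1,0}_gG\to G$ by $\exp_g(\xi)=\gamma_\xi(1)$, where $\gamma_\xi:\mathbb C\to G$ is the holomorphic curve with $\gamma_\xi'=\tilde\xi_{\gamma_\xi}$ and $\gamma_\xi(0)=g$. Then, for every $g\in G$ and every $\xi\in T^{1,0}_gG$, the curve $\gamma_\xi$ exists and is unique, the map $\exp_g$ is complex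 differentiable at $\xi$ (so $\exp_g$ is well defined and holomorphic), and its differential $(d\exp_g)_\xi:T^{1,0}_gG\to T^{1,0}_{\exp_g(\xi)}G$, where $T^{1,0}_\xi(T^{1,0}_gG)$ is identified with $T^{1,0}_gG$ canonically and isometrically, satisfies $$\|(d\exp_g)_\xi\|:=\sup_{\eta\ne 0}\frac{\|(d\exp_g)_\xi(\eta)\|}{\|\eta\|}\ \le\ \frac{e^{C_{\mathfrak g}\|\xi\|}-1}{C_{\mathfrak g}\|\xi\|},$$ where the right-hand side is read as its limit value $1$ when $C_{\mathfrak g}\|\xi\|=0$ (and the supremum as $0$ if $\mathfrak g=0$). -/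

import Mathlib

open scoped Manifold ContDiff

noncomputable section

namespace ComplexLieGroup

variable {E : Type*} [NormedAddCommGroup E] [NormedSpace ℂ E]
  {G : Type*} [TopologicalSpace G] [ChartedSpace E G]

/-! For a complex manifold `G` modelled on `E`, the complex vector space
`TangentSpace 𝓘(ℂ, E) g` is the holomorphic tangent space of `G` at `g`. -/

variable (E G) in
/-- A Hermitian metric on a complex manifold: a Hermitian inner product on every holomorphic
tangent space, whose coefficients in the charts are smooth functions (in the real sense). -/
structure HermitianMetric where
  /-- The inner product on the tangent space at `g`. -/
  core (g : G) : InnerProductSpace.Core ℂ (TangentSpace 𝓘(ℂ, E) g)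
  smooth (p : G) (v w : E) :
    ContDiffOn ℝ ∞
      (fun x : E ↦ (core ((chartAt E p).symm x)).inner
        (mfderiv 𝓘(ℂ, E) 𝓘(ℂ, E) (chartAt E p).symm x v)
        (mfderiv 𝓘(ℂ, E) 𝓘(ℂ, E) (chartAt E p).symm x w))
      (chartAt E p).target

namespace HermitianMetric

variable (h : HermitianMetric E G)

/-- The inner product of two tangent vectors at `g`. -/
def inner (g : G) (ξ η : TangentSpace 𝓘(ℂ, E) g) : ℂ := (h.core g).inner ξ η

/-- The norm of a tangent vector at `g`. -/
def norm (g : G) (ξ : TangentSpace 𝓘(ℂ, E) g) : ℝ := √(h.inner g ξ ξ).re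

/-- The operator norm `sup_η ‖A η‖ / ‖η‖` of a linear map between two tangent spaces
(the vector `η = 0` contributes the value `0` to the supremum). -/
def opNorm (g k : G) (A : TangentSpace 𝓘(ℂ, E) g →L[ℂ] TangentSpace 𝓘(ℂ, E) k) : ℝ :=
  ⨆ η : TangentSpace 𝓘(ℂ, E) g, h.norm k (A η) / h.norm g η

variable [Group G]

/-- All left translations preserve the metric. -/
def IsLeftInvariant : Prop :=
  ∀ (a g : G) (ξ η : TangentSpace 𝓘(ℂ, E) g),
    h.inner (a * g)
      (mfderiv 𝓘(ℂ, E) 𝓘(ℂ, E) (fun x : G ↦ a * x) g ξ)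
      (mfderiv 𝓘(ℂ, E) 𝓘(ℂ, E) (fun x : G ↦ a * x) g η) = h.inner g ξ η

/-- The structure constant `sup {‖[X, Y]‖ : X, Y ∈ 𝔤, ‖X‖ = ‖Y‖ = 1}`; the bracket is that of
left-invariant holomorphic vector fields. (If `𝔤 = 0`, the set is empty and the value is `0`.) -/
def structureConstant : ℝ :=
  sSup {r : ℝ | ∃ X Y : GroupLieAlgebra 𝓘(ℂ, E) G,
    h.norm 1 X = 1 ∧ h.norm 1 Y = 1 ∧ r = h.norm 1 ⁅X, Y⁆}

end HermitianMetric

variable [Group G]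

/-- The value at `1` of the left-invariant field generated by `ξ`, that is `(dL_{g⁻¹})_g ξ`.
The ascription only uses `g⁻¹ * g = 1`. -/
def toLieAlgebra (g : G) (ξ : TangentSpace 𝓘(ℂ, E) g) : GroupLieAlgebra 𝓘(ℂ, E) G :=
  (mfderiv 𝓘(ℂ, E) 𝓘(ℂ, E) (fun x : G ↦ g⁻¹ * x) g ξ :
    TangentSpace 𝓘(ℂ, E) (g⁻¹ * g))

/-- The left-invariant vector field `k ↦ (dL_k)_1 ((dL_{g⁻¹})_g ξ)` generated by `ξ ∈ T_g G`. -/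
def leftInvariantField (g : G) (ξ : TangentSpace 𝓘(ℂ, E) g) (k : G) :
    TangentSpace 𝓘(ℂ, E) k :=
  mulInvariantVectorField (toLieAlgebra g ξ) k

/-- `γ : ℂ → G` is a holomorphic solution of `γ' = ξ̃ ∘ γ`, `γ 0 = g`, where `ξ̃` is the
left-invariant field generated by `ξ ∈ T_g G`. -/
def IsExpCurve (g : G) (ξ : TangentSpace 𝓘(ℂ, E) g) (γ : ℂ → G) : Prop :=
  γ 0 = g ∧ ∀ z : ℂ, HasMFDerivAt 𝓘(ℂ, ℂ) 𝓘(ℂ, E) γ z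
    ((1 : ℂ →L[ℂ] ℂ).smulRight (leftInvariantField g ξ (γ z)))

open Classical in
/-- The exponential map `exp_g : T_g G → G`, `exp_g ξ = γ_ξ 1`, where `γ_ξ` is the solution of
`γ' = ξ̃ ∘ γ`, `γ 0 = g` (the value `g` is a dummy for the case without a solution). -/
def expAt (g : G) (ξ : TangentSpace 𝓘(ℂ, E) g) : G :=
  if H : ∃ γ : ℂ → G, IsExpCurve g ξ γ then H.choose 1 else g

variable (E) in
/-- `exp_g` as a map on the vector space `T_g G`, which is `E`, with its linear complex
structure. -/
def expMap (g : G) : E → G := fun ξ ↦ expAt (E := E) g ξ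

/-- The differential of `exp_g` at `ξ`, where `T_ξ (T_g G)` is identified with `T_g G` by the
canonical isomorphism. -/
def dexpAt (g : G) (ξ : TangentSpace 𝓘(ℂ, E) g) :
    TangentSpace 𝓘(ℂ, E) g →L[ℂ] TangentSpace 𝓘(ℂ, E) (expAt g ξ) :=
  mfderiv 𝓘(ℂ, E) 𝓘(ℂ, E) (expMap E g) ξ

/-- The entire function `(e ^ t - 1) / t`, with its limit value `1` at `t = 0`. -/
def expQuotient (t : ℝ) : ℝ := if t = 0 then 1 else (Real.exp t - 1) / t

end ComplexLieGroup

end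

/-! The exponential map is built without solving a differential equation. Near the identity,
squaring has differential `2 • id`, so it has a local inverse `σ` (the square root) with
differential `2⁻¹ • id`. Such a contraction is conjugate to multiplication by `1/2`: `L = lim 2^n
σ^n` satisfies `L ∘ σ = L / 2` (`exists_linearization_of_fderiv_eq_half`). The inverse germ `e` of
`L` then satisfies `e (2x) = e(x)²`. A germ tangent to the identity that commutes with halving is
the identity, and this upgrades the relation to `e (m x) = e(x)^m`; repeated doubling makes it
global (`exists_lieExp`).

Differentials are read in the Lie algebra through the left logarithmic derivative, which obeys
`δ(fg) = Ad(g⁻¹) δf + δg` (`leftDeriv_mul`). Solutions of `γ' = ξ̃ ∘ γ` are the curves with constant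
`δγ`. The curve `z ↦ g Exp(zX)` is one, and the product rule shows that `γ(z) Exp(-zX)` is constant
for any other.

For the bound, differentiate `Exp(x) = Exp(x/n)^n` by the product rule: `n δExp(x) = ∑_{k<n}
Ad(Exp(-x/n))^k δExp(x/n)`. The derivative of `Ad` at the identity is the bracket
(`exists_hasFDerivAt_adjoint_par`, `bracket_eq_mulHess`), so `Ad(Exp(-x/n))` has norm at most `1 +
(c + δ)/n` with `c = C ‖x‖`, while `δExp(x/n)` tends to the identity. The geometric sum is at most
`n (e^κ - 1)/κ` with `κ = c + δ`; dividing by `n` and letting `δ → 0` gives the estimate. Left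
invariance of the metric carries it from the identity to any `g`. -/

/-! ### Germs of holomorphic maps: linearization, rigidity and local inverses. -/

-- Koenigs linearization: `L` is the limit of `2^n σ^n`, written as a telescoping series so that it
-- and its derivative converge uniformly by geometric domination.
open Filter Topology Metric Set in
theorem exists_linearization_of_fderiv_eq_half {E : Type*} [NormedAddCommGroup E]
    [NormedSpace ℂ E] [CompleteSpace E] {σ : E → E} (hσ : ContDiffAt ℂ 2 σ 0) (h0 : σ 0 = 0)
    (hd : fderiv ℂ σ 0 = (2⁻¹ : ℂ) • ContinuousLinearMap.id ℂ E) :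
    ∃ L : E → E, ContDiffAt ℂ 1 L 0 ∧ L 0 = 0 ∧
      HasFDerivAt L (ContinuousLinearMap.id ℂ E) 0 ∧
      ∀ᶠ x in 𝓝 0, L (σ x) = (2⁻¹ : ℂ) • L x := by
  have hf1 : ContDiffAt ℂ 1 (fderiv ℂ σ) 0 := hσ.fderiv_right (by norm_num)
  obtain ⟨K, t, ht, hK⟩ := hf1.exists_lipschitzOnWith
  -- Any rate `q` with `1/2 < q` and `2 q² < 1` would do. With `q = 3/5` the series below has ratio
  -- `2 q² = 18/25`.
  have hq : ∀ᶠ x in 𝓝 (0 : E), ‖fderiv ℂ σ x‖ < 3 / 5 := by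
    refine hf1.continuousAt.norm.eventually (gt_mem_nhds ?_)
    beta_reduce
    rw [hd, norm_smul]
    have := ContinuousLinearMap.norm_id_le (𝕜 := ℂ) (E := E)
    norm_num
    linarith
  have hc : ∀ᶠ x in 𝓝 (0 : E), ContDiffAt ℂ 1 σ x :=
    (hσ.of_le (by norm_num : (1 : WithTop ℕ∞) ≤ 2)).eventually (by simp)
  obtain ⟨r, hr, hball⟩ := Metric.eventually_nhds_iff_ball.1
    ((hq.and hc).and (eventually_mem_set.2 ht))
  set B := ball (0 : E) r
  have hBo : IsOpen B := isOpen_ball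
  have h0B : (0 : E) ∈ B := mem_ball_self hr
  have hB : Convex ℝ B := convex_ball _ _
  have hσB : ContDiffOn ℂ 1 σ B := fun x hx ↦ (hball x hx).1.2.contDiffWithinAt
  have hq' : ∀ x ∈ B, ‖σ x‖ ≤ 3 / 5 * ‖x‖ := by
    intro x hx
    have := hB.norm_image_sub_le_of_norm_fderiv_le (𝕜 := ℂ) (f := σ) (C := 3 / 5)
      (fun y hy ↦ (hball y hy).1.2.differentiableAt (by simp))
      (fun y hy ↦ (hball y hy).1.1.le) h0B hx
    simpa [h0] using this
  have hmaps : MapsTo σ B B := by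
    intro x hx
    have h1 := hq' x hx
    have h2 : ‖x‖ < r := by simpa [B] using hx
    simp only [B, mem_ball_zero_iff]
    nlinarith [norm_nonneg x]
  have hiter : ∀ n, ∀ x ∈ B, σ^[n] x ∈ B := fun n x hx ↦ hmaps.iterate n hx
  have hitn : ∀ n, ∀ x ∈ B, ‖σ^[n] x‖ ≤ (3 / 5) ^ n * ‖x‖ := by
    intro n
    induction n with
    | zero => intro x _; simp
    | succ n ih =>
      intro x hx
      rw [Function.iterate_succ_apply']
      calc _ ≤ 3 / 5 * ‖σ^[n] x‖ := hq' _ (hiter n x hx)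
        _ ≤ 3 / 5 * ((3 / 5) ^ n * ‖x‖) := by gcongr; exact ih x hx
        _ = _ := by ring
  have hitc : ∀ n, ContDiffOn ℂ 1 (σ^[n]) B := by
    intro n
    induction n with
    | zero => exact contDiffOn_id
    | succ n ih =>
      rw [Function.iterate_succ']
      exact hσB.comp ih (hiter n)
  have hdiff : ∀ {f : E → E}, ContDiffOn ℂ 1 f B → ∀ x ∈ B, DifferentiableAt ℂ f x :=
    fun hf x hx ↦ (hf.contDiffAt (hBo.mem_nhds hx)).differentiableAt (by simp)
  have hitd : ∀ n, ∀ x ∈ B, ‖fderiv ℂ (σ^[n]) x‖ ≤ (3 / 5) ^ n := by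
    intro n
    induction n with
    | zero => intro x _; simpa using ContinuousLinearMap.norm_id_le (𝕜 := ℂ) (E := E)
    | succ n ih =>
      intro x hx
      rw [Function.iterate_succ', fderiv_comp _ (hdiff hσB _ (hiter n x hx)) (hdiff (hitc n) x hx)]
      calc _ ≤ ‖fderiv ℂ σ (σ^[n] x)‖ * ‖fderiv ℂ (σ^[n]) x‖ :=
            ContinuousLinearMap.opNorm_comp_le _ _
        _ ≤ (3 / 5) * (3 / 5) ^ n := by
            gcongr
            · exact (hball _ (hiter n x hx)).1.1.le
            · exact ih x hx
        _ = _ := by ring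
  -- The defect of `σ` from halving. Its derivative vanishes at `0` and is Lipschitz, hence
  -- `O(‖x‖)`; this supplies the second factor `q^n` that beats `2^n`.
  set g : E → E := fun y ↦ (2 : ℂ) • σ y - y with hg
  have hgc : ContDiffOn ℂ 1 g B := (hσB.const_smul (2 : ℂ)).sub contDiffOn_id
  have hg0 : g 0 = 0 := by simp [hg, h0]
  have hgd : ∀ x ∈ B, fderiv ℂ g x = (2 : ℂ) • (fderiv ℂ σ x - fderiv ℂ σ 0) := by
    intro x hx
    have : HasFDerivAt g ((2 : ℂ) • fderiv ℂ σ x - ContinuousLinearMap.id ℂ E) x :=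
      ((hdiff hσB x hx).hasFDerivAt.const_smul (2 : ℂ)).sub (hasFDerivAt_id x)
    rw [this.fderiv, hd, smul_sub, smul_smul]
    norm_num
  have hgn : ∀ x ∈ B, ‖fderiv ℂ g x‖ ≤ 2 * K * ‖x‖ := by
    intro x hx
    rw [hgd x hx, norm_smul]
    have := hK.norm_sub_le (hball x hx).2 (hball 0 h0B).2
    rw [sub_zero] at this
    norm_num
    nlinarith
  -- `u n = 2^(n+1) σ^(n+1) - 2^n σ^n`, so `x + ∑ u n x` is the limit of `2^n σ^n x`.
  set u : ℕ → E → E := fun n x ↦ (2 ^ n : ℂ) • g (σ^[n] x) with hu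
  have huc : ∀ n, ContDiffOn ℂ 1 (u n) B := fun n ↦
    (hgc.comp (hitc n) (hiter n)).const_smul _
  have hun : ∀ n, ∀ x ∈ B, ‖fderiv ℂ (u n) x‖ ≤ 2 * K * r * (18 / 25) ^ n := by
    intro n x hx
    have h1 : HasFDerivAt (u n)
        ((2 ^ n : ℂ) • (fderiv ℂ g (σ^[n] x)).comp (fderiv ℂ (σ^[n]) x)) x :=
      ((hdiff hgc _ (hiter n x hx)).hasFDerivAt.comp x
        (hdiff (hitc n) x hx).hasFDerivAt).const_smul _
    have hxr : ‖x‖ ≤ r := (mem_ball_zero_iff.1 hx).le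
    rw [h1.fderiv, norm_smul, norm_pow, RCLike.norm_ofNat]
    calc _ ≤ 2 ^ n * (‖fderiv ℂ g (σ^[n] x)‖ * ‖fderiv ℂ (σ^[n]) x‖) := by
          gcongr; exact ContinuousLinearMap.opNorm_comp_le _ _
      _ ≤ 2 ^ n * ((2 * K * ((3 / 5) ^ n * r)) * (3 / 5) ^ n) := by
          gcongr
          · refine (hgn _ (hiter n x hx)).trans ?_
            gcongr
            exact (hitn n x hx).trans (by gcongr)
          · exact hitd n x hx
      _ = 2 * K * r * (2 * (3 / 5) * (3 / 5)) ^ n := by rw [mul_pow, mul_pow]; ring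
      _ = _ := by norm_num
  have hsum : Summable fun n : ℕ ↦ 2 * K * r * (18 / 25 : ℝ) ^ n :=
    (summable_geometric_of_lt_one (by norm_num) (by norm_num)).mul_left _
  have hu0 : ∀ n, u n 0 = 0 := by
    intro n
    have : σ^[n] 0 = 0 := Function.iterate_fixed h0 n
    simp [hu, this, hg0]
  have hs0 : Summable fun n ↦ u n 0 := by simp [hu0]
  have hud : ∀ n, ∀ x ∈ B, HasFDerivAt (u n) (fderiv ℂ (u n) x) x :=
    fun n x hx ↦ (hdiff (huc n) x hx).hasFDerivAt
  have hU : ∀ x ∈ B, HasFDerivAt (fun y ↦ ∑' n, u n y) (∑' n, fderiv ℂ (u n) x) x :=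
    fun x hx ↦ hasFDerivAt_tsum_of_isPreconnected hsum hBo hB.isPreconnected hud hun h0B hs0 hx
  have hUs : ∀ x ∈ B, Summable fun n ↦ u n x := fun x hx ↦
    summable_of_summable_hasFDerivAt_of_isPreconnected hsum hBo hB.isPreconnected hud hun
      h0B hs0 hx
  have hL : ∀ x ∈ B, HasFDerivAt (fun y ↦ y + ∑' n, u n y)
      (ContinuousLinearMap.id ℂ E + ∑' n, fderiv ℂ (u n) x) x :=
    fun x hx ↦ (hasFDerivAt_id x).add (hU x hx)
  have hud0 : ∀ n, fderiv ℂ (u n) 0 = 0 := by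
    intro n
    have hi : σ^[n] 0 = 0 := Function.iterate_fixed h0 n
    have h1 : HasFDerivAt (u n)
        ((2 ^ n : ℂ) • (fderiv ℂ g (σ^[n] 0)).comp (fderiv ℂ (σ^[n]) 0)) 0 :=
      ((hdiff hgc _ (hiter n 0 h0B)).hasFDerivAt.comp 0
        (hdiff (hitc n) 0 h0B).hasFDerivAt).const_smul _
    rw [h1.fderiv, hi, hgd 0 h0B]
    simp
  refine ⟨fun y ↦ y + ∑' n, u n y, ?_, by simp [hu0], ?_, ?_⟩
  · rw [contDiffAt_one_iff]
    refine ⟨_, B, hBo.mem_nhds h0B, ?_, hL⟩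
    refine continuousOn_const.add (continuousOn_tsum (fun n ↦ ?_) hsum hun)
    exact (huc n).continuousOn_fderiv_of_isOpen hBo (by simp)
  · simpa [hud0] using hL 0 h0B
  -- Shifting the index gives `∑ u n x = g x + 2 ∑ u n (σ x)`, and `x + g x = 2 σ x`; hence `L x = 2
  -- L (σ x)`.
  · filter_upwards [hBo.mem_nhds h0B] with x hx
    have h1 : ∑' n, u n x = g x + ∑' n, u (n + 1) x := by
      rw [(hUs x hx).tsum_eq_zero_add]; simp [hu]
    have h2 : ∑' n, u (n + 1) x = (2 : ℂ) • ∑' n, u n (σ x) := by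
      rw [← tsum_const_smul'']
      refine tsum_congr fun n ↦ ?_
      simp only [hu, Function.iterate_succ_apply, smul_smul, pow_succ']
    rw [h1, h2, hg]
    simp only [smul_add, smul_sub, smul_smul]
    norm_num
    abel

-- Iterating gives `w x = 2^n w(2^{-n} x)`, a difference quotient at `0` that tends to the
-- derivative applied to `x`.
open Filter Topology Metric Set in
theorem eventually_eq_of_commute_half {E : Type*} [NormedAddCommGroup E] [NormedSpace ℂ E]
    {w : E → E} (h0 : w 0 = 0) (hd : HasFDerivAt w (ContinuousLinearMap.id ℂ E) 0)
    (hw : ∀ᶠ x in 𝓝 0, w ((2⁻¹ : ℂ) • x) = (2⁻¹ : ℂ) • w x) : ∀ᶠ x in 𝓝 0, w x = x := by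
  obtain ⟨r, hr, hball⟩ := Metric.eventually_nhds_iff_ball.1 hw
  filter_upwards [ball_mem_nhds (0 : E) hr] with x hx
  have hx' : ∀ n : ℕ, (2⁻¹ : ℂ) ^ n • x ∈ ball (0 : E) r := by
    intro n
    rw [mem_ball_zero_iff] at hx ⊢
    rw [norm_smul, norm_pow]
    refine lt_of_le_of_lt (mul_le_of_le_one_left (norm_nonneg _) (pow_le_one₀ ?_ ?_)) hx <;>
      norm_num
  have hn : ∀ n : ℕ, w ((2⁻¹ : ℂ) ^ n • x) = (2⁻¹ : ℂ) ^ n • w x := by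
    intro n
    induction n with
    | zero => simp
    | succ n ih =>
      rw [pow_succ', mul_smul, hball _ (hx' n), ih, smul_smul]
  have hlim : Tendsto (fun n : ℕ ↦ (2 : ℂ) ^ n • (w (0 + (2⁻¹ : ℂ) ^ n • x) - w 0)) atTop
      (𝓝 (ContinuousLinearMap.id ℂ E x)) := by
    have h := hd.lim x (c := fun n : ℕ ↦ (2 : ℂ) ^ n) (l := atTop) (by
      simpa using tendsto_pow_atTop_atTop_of_one_lt (one_lt_two : (1 : ℝ) < 2))
    simpa only [inv_pow] using h
  have hconst : (fun n : ℕ ↦ (2 : ℂ) ^ n • (w (0 + (2⁻¹ : ℂ) ^ n • x) - w 0)) = fun _ ↦ w x := by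
    ext n
    rw [zero_add, hn, h0, sub_zero, smul_smul, ← mul_pow]
    norm_num
  rw [hconst] at hlim
  exact tendsto_nhds_unique tendsto_const_nhds hlim

open Filter Topology in
theorem exists_local_inverse_of_hasFDerivAt_smul_id {E : Type*} [NormedAddCommGroup E]
    [NormedSpace ℂ E] [CompleteSpace E] {n : WithTop ℕ∞} {f : E → E} (hf : ContDiffAt ℂ n f 0)
    (hn : n ≠ 0) (h0 : f 0 = 0) {c : ℂ} (hc : c ≠ 0)
    (hd : HasFDerivAt f (c • ContinuousLinearMap.id ℂ E) 0) :
    ∃ g : E → E, ContDiffAt ℂ n g 0 ∧ g 0 = 0 ∧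
      HasFDerivAt g (c⁻¹ • ContinuousLinearMap.id ℂ E) 0 ∧
      (∀ᶠ y in 𝓝 0, f (g y) = y) ∧ ∀ᶠ x in 𝓝 0, g (f x) = x := by
  let A : E ≃L[ℂ] E := ContinuousLinearEquiv.smulLeft (Units.mk0 c hc)
  have hA : (A : E →L[ℂ] E) = c • ContinuousLinearMap.id ℂ E := by ext; rfl
  have hd' : HasFDerivAt f (A : E →L[ℂ] E) 0 := hA ▸ hd
  have hs := hf.hasStrictFDerivAt' hd' hn
  have hg0 : hf.localInverse hd' hn 0 = 0 := by
    simpa [h0] using hf.localInverse_apply_image hd' hn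
  have hgc : ContDiffAt ℂ n (hf.localInverse hd' hn) 0 := by
    simpa [h0] using hf.to_localInverse hd' hn
  have hr : ∀ᶠ y in 𝓝 0, f (hf.localInverse hd' hn y) = y := by
    have := hs.eventually_right_inverse
    rwa [h0] at this
  refine ⟨_, hgc, hg0, ?_, hr, hs.eventually_left_inverse⟩
  have hgd := (hgc.differentiableAt hn).hasFDerivAt
  have hcomp : HasFDerivAt (fun y ↦ f (hf.localInverse hd' hn y))
      ((c • ContinuousLinearMap.id ℂ E).comp (fderiv ℂ (hf.localInverse hd' hn) 0)) 0 :=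
    HasFDerivAt.comp 0 (by rwa [hg0]) hgd
  have hid := hcomp.unique ((hasFDerivAt_id (𝕜 := ℂ) (0 : E)).congr_of_eventuallyEq hr)
  have : fderiv ℂ (hf.localInverse hd' hn) 0 = c⁻¹ • ContinuousLinearMap.id ℂ E := by
    rw [← hid]; ext x; simp [smul_smul, hc]
  rwa [this] at hgd

noncomputable section

namespace ComplexLieGroup

open Filter Topology

/-! ### Coordinates centred at the identity. -/

section Coordinates

variable {E : Type*} [NormedAddCommGroup E]
  {G : Type*} [TopologicalSpace G] [ChartedSpace E G] [Group G]

variable (E) in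
/-- The chart at the identity, translated so that it maps the identity to `0`. -/
def coord (x : G) : E := chartAt E (1 : G) x - chartAt E (1 : G) (1 : G)

variable (G) in
/-- The local inverse of `coord`. -/
def par (v : E) : G := (chartAt E (1 : G)).symm (v + chartAt E (1 : G) (1 : G))

@[simp] theorem coord_one : coord E (1 : G) = 0 := sub_self _

@[simp] theorem par_zero : par G (0 : E) = 1 := by simp [par]

theorem eventually_par_coord : ∀ᶠ x in 𝓝 (1 : G), par G (coord E x) = x := by
  filter_upwards [(chartAt E (1 : G)).open_source.mem_nhds (mem_chart_source E (1 : G))] with x hx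
  simp [par, coord, hx]

theorem eventually_add_mem_target :
    ∀ᶠ v in 𝓝 (0 : E), v + chartAt E (1 : G) (1 : G) ∈ (chartAt E (1 : G)).target := by
  have : ContinuousAt (fun v : E ↦ v + chartAt E (1 : G) (1 : G)) 0 := by fun_prop
  exact this.eventually ((chartAt E (1 : G)).open_target.mem_nhds (by simp))

theorem eventually_coord_par : ∀ᶠ v in 𝓝 (0 : E), coord E (par G v) = v := by
  filter_upwards [eventually_add_mem_target (E := E) (G := G)] with v hv
  simp [par, coord, hv]

variable (E G) in
/-- The multiplication in the coordinates at the identity. -/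
def mulCoord (p : E × E) : E := coord E (par G p.1 * par G p.2)

theorem eventually_mulCoord_zero_right : ∀ᶠ x in 𝓝 (0 : E), mulCoord E G (x, 0) = x := by
  filter_upwards [eventually_coord_par (E := E) (G := G)] with x hx
  simp [mulCoord, hx]

theorem eventually_mulCoord_zero_left : ∀ᶠ x in 𝓝 (0 : E), mulCoord E G (0, x) = x := by
  filter_upwards [eventually_coord_par (E := E) (G := G)] with x hx
  simp [mulCoord, hx]

variable (E G) in
/-- The `m`-th power map in the coordinates at the identity. -/
def powCoord (m : ℕ) (x : E) : E := coord E (par G x ^ m)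

@[simp] theorem powCoord_zero (m : ℕ) : powCoord E G m 0 = 0 := by simp [powCoord]

variable [NormedSpace ℂ E] [IsManifold 𝓘(ℂ, E) ω G]

theorem eventually_contMDiffAt_coord :
    ∀ᶠ x in 𝓝 (1 : G), ContMDiffAt 𝓘(ℂ, E) 𝓘(ℂ, E) ω (coord E) x := by
  filter_upwards [(chartAt E (1 : G)).open_source.mem_nhds (mem_chart_source E (1 : G))] with x hx
  have h : ContMDiffAt 𝓘(ℂ, E) 𝓘(ℂ, E) ω (chartAt E (1 : G)) x :=
    (contMDiffOn_chart (I := 𝓘(ℂ, E)) (n := ω) (x := (1 : G))).contMDiffAt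
      ((chartAt E (1 : G)).open_source.mem_nhds hx)
  have h2 : ContMDiffAt 𝓘(ℂ, E) 𝓘(ℂ, E) ω (fun v : E ↦ v - chartAt E (1 : G) (1 : G))
      (chartAt E (1 : G) x) := by
    apply ContDiffAt.contMDiffAt; fun_prop
  exact h2.comp x h

theorem eventually_contMDiffAt_par :
    ∀ᶠ v in 𝓝 (0 : E), ContMDiffAt 𝓘(ℂ, E) 𝓘(ℂ, E) ω (par G) v := by
  filter_upwards [eventually_add_mem_target (E := E) (G := G)] with v hv
  have h : ContMDiffAt 𝓘(ℂ, E) 𝓘(ℂ, E) ω (chartAt E (1 : G)).symm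
      (v + chartAt E (1 : G) (1 : G)) :=
    (contMDiffOn_chart_symm (I := 𝓘(ℂ, E)) (n := ω) (x := (1 : G))).contMDiffAt
      ((chartAt E (1 : G)).open_target.mem_nhds hv)
  have h2 : ContMDiffAt 𝓘(ℂ, E) 𝓘(ℂ, E) ω (fun v : E ↦ v + chartAt E (1 : G) (1 : G)) v := by
    apply ContDiffAt.contMDiffAt; fun_prop
  exact h.comp v h2

theorem contMDiffAt_coord : ContMDiffAt 𝓘(ℂ, E) 𝓘(ℂ, E) ω (coord E) (1 : G) :=
  eventually_contMDiffAt_coord.self_of_nhds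

theorem contMDiffAt_par : ContMDiffAt 𝓘(ℂ, E) 𝓘(ℂ, E) ω (par G) (0 : E) :=
  eventually_contMDiffAt_par.self_of_nhds

theorem continuousAt_par : ContinuousAt (par G) (0 : E) := contMDiffAt_par.continuousAt

theorem continuousAt_coord : ContinuousAt (coord E) (1 : G) := contMDiffAt_coord.continuousAt

theorem hasMFDerivAt_coord : HasMFDerivAt 𝓘(ℂ, E) 𝓘(ℂ, E) (coord E) (1 : G)
    (ContinuousLinearMap.id ℂ E) := by
  have h := (hasFDerivAt_id (𝕜 := ℂ) (chartAt E (1 : G) (1 : G))).sub_const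
    (chartAt E (1 : G) (1 : G))
  have h' : HasFDerivAt (writtenInExtChartAt 𝓘(ℂ, E) 𝓘(ℂ, E) (1 : G) (coord E))
      (ContinuousLinearMap.id ℂ E) (chartAt E (1 : G) (1 : G)) := by
    refine h.congr_of_eventuallyEq ?_
    filter_upwards [(chartAt E (1 : G)).open_target.mem_nhds
      ((chartAt E (1 : G)).map_source (mem_chart_source E (1 : G)))] with v hv
    simp [writtenInExtChartAt, coord, hv, chartAt_self_eq]
  exact ⟨continuousAt_coord, h'.hasFDerivWithinAt⟩

theorem hasMFDerivAt_par : HasMFDerivAt 𝓘(ℂ, E) 𝓘(ℂ, E) (par G) (0 : E)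
    (ContinuousLinearMap.id ℂ E) := by
  have h := (hasFDerivAt_id (𝕜 := ℂ) (0 : E)).add_const (chartAt E (1 : G) (1 : G))
  have h' : HasFDerivAt (writtenInExtChartAt 𝓘(ℂ, E) 𝓘(ℂ, E) (0 : E) (par G))
      (ContinuousLinearMap.id ℂ E) 0 := by
    refine h.congr_of_eventuallyEq ?_
    filter_upwards [eventually_add_mem_target (E := E) (G := G)] with v hv
    simp [writtenInExtChartAt, par, hv, chartAt_self_eq]
  exact ⟨continuousAt_par, h'.hasFDerivWithinAt⟩

end Coordinates

/-! ### Multiplication and powers in coordinates; the germ of the exponential map. -/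

section LocalGroup

variable {E : Type*} [NormedAddCommGroup E] [NormedSpace ℂ E]
  {G : Type*} [TopologicalSpace G] [ChartedSpace E G] [Group G] [LieGroup 𝓘(ℂ, E) ω G]

/-- The coordinates of a smooth `G`-valued map are smooth where the map takes the value `1`. -/
theorem contDiffAt_coord_comp {F : Type*} [NormedAddCommGroup F] [NormedSpace ℂ F] {f : F → G}
    {x : F} {n : WithTop ℕ∞} (hf : ContMDiffAt 𝓘(ℂ, F) 𝓘(ℂ, E) n f x) (hx : f x = 1) :
    ContDiffAt ℂ n (fun y ↦ coord E (f y)) x := by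
  have h : ContMDiffAt 𝓘(ℂ, E) 𝓘(ℂ, E) n (coord E) (f x) := by
    rw [hx]; exact contMDiffAt_coord.of_le le_top
  exact (h.comp x hf).contDiffAt

theorem contMDiffAt_par_comp {F : Type*} [NormedAddCommGroup F] [NormedSpace ℂ F] {f : F → E}
    {x : F} {n : WithTop ℕ∞} (hf : ContDiffAt ℂ n f x) (hx : f x = 0) :
    ContMDiffAt 𝓘(ℂ, F) 𝓘(ℂ, E) n (fun y ↦ par G (f y)) x := by
  have h : ContMDiffAt 𝓘(ℂ, E) 𝓘(ℂ, E) n (par G) (f x) := by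
    rw [hx]; exact contMDiffAt_par.of_le le_top
  exact h.comp x hf.contMDiffAt

theorem contDiffAt_mulCoord : ContDiffAt ℂ ω (mulCoord E G) 0 := by
  refine contDiffAt_coord_comp (ContMDiffAt.mul (I := 𝓘(ℂ, E)) ?_ ?_) (by simp)
  · exact contMDiffAt_par_comp contDiffAt_fst rfl
  · exact contMDiffAt_par_comp contDiffAt_snd rfl

theorem hasFDerivAt_mulCoord : HasFDerivAt (mulCoord E G)
    (ContinuousLinearMap.fst ℂ E E + ContinuousLinearMap.snd ℂ E E) 0 := by
  have hd := ((contDiffAt_mulCoord (E := E) (G := G)).differentiableAt (by simp)).hasFDerivAt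
  have h1 := (HasFDerivAt.comp (0 : E) (f := fun x : E ↦ (x, (0 : E))) hd
    (hasFDerivAt_prodMk_left (0 : E) (0 : E))).unique
      ((hasFDerivAt_id (𝕜 := ℂ) (0 : E)).congr_of_eventuallyEq
        (eventually_mulCoord_zero_right (G := G)))
  have h2 := (HasFDerivAt.comp (0 : E) (f := fun x : E ↦ ((0 : E), x)) hd
    (hasFDerivAt_prodMk_right (0 : E) (0 : E))).unique
      ((hasFDerivAt_id (𝕜 := ℂ) (0 : E)).congr_of_eventuallyEq
        (eventually_mulCoord_zero_left (G := G)))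
  convert! hd using 1
  ext x
  · simpa using congr($h1 x).symm
  · simpa using congr($h2 x).symm

theorem contDiffAt_powCoord (m : ℕ) : ContDiffAt ℂ ω (powCoord E G m) 0 := by
  refine contDiffAt_coord_comp (f := fun x ↦ par G x ^ m) ?_ (by simp)
  exact (contMDiff_pow (I := 𝓘(ℂ, E)) m).contMDiffAt.comp (0 : E) contMDiffAt_par

theorem continuousAt_par_pow (m : ℕ) : ContinuousAt (fun x : E ↦ par G x ^ m) 0 :=
  ((contMDiff_pow (I := 𝓘(ℂ, E)) (n := ω) (G := G) m).continuous.continuousAt).comp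
    continuousAt_par

theorem eventually_par_powCoord (m : ℕ) :
    ∀ᶠ x in 𝓝 (0 : E), par G (powCoord E G m x) = par G x ^ m :=
  (continuousAt_par_pow m).tendsto.eventually
    (by simpa using eventually_par_coord (E := E) (G := G))

theorem hasFDerivAt_powCoord (m : ℕ) :
    HasFDerivAt (powCoord E G m) ((m : ℂ) • ContinuousLinearMap.id ℂ E) 0 := by
  induction m with
  | zero =>
    have h : powCoord E G 0 = fun _ ↦ 0 := by ext; simp [powCoord]
    simpa [h] using hasFDerivAt_const (𝕜 := ℂ) (0 : E) (0 : E)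
  | succ m ih =>
    have h1 : HasFDerivAt (fun x ↦ mulCoord E G (powCoord E G m x, x))
        ((ContinuousLinearMap.fst ℂ E E + ContinuousLinearMap.snd ℂ E E).comp
          (((m : ℂ) • ContinuousLinearMap.id ℂ E).prod (ContinuousLinearMap.id ℂ E))) 0 := by
      refine HasFDerivAt.comp (g := mulCoord E G) (f := fun x ↦ (powCoord E G m x, x)) (0 : E) ?_
        (ih.prodMk (hasFDerivAt_id 0))
      simpa using! hasFDerivAt_mulCoord (E := E) (G := G)
    have h2 : HasFDerivAt (powCoord E G (m + 1))
        ((ContinuousLinearMap.fst ℂ E E + ContinuousLinearMap.snd ℂ E E).comp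
          (((m : ℂ) • ContinuousLinearMap.id ℂ E).prod (ContinuousLinearMap.id ℂ E))) 0 := by
      refine h1.congr_of_eventuallyEq ?_
      filter_upwards [eventually_par_powCoord (E := E) (G := G) m] with x hx
      rw [mulCoord, hx, powCoord, pow_succ]
    convert! h2 using 1
    ext x
    simp [add_smul]

/-- The germ of the exponential map in coordinates. -/
theorem exists_expGerm [CompleteSpace E] : ∃ e : E → E, ContDiffAt ℂ 1 e 0 ∧ e 0 = 0 ∧
    HasFDerivAt e (ContinuousLinearMap.id ℂ E) 0 ∧
    ∀ m : ℕ, ∀ᶠ x in 𝓝 0, par G (e ((m : ℂ) • x)) = par G (e x) ^ m := by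
  obtain ⟨σ, hσc, hσ0, hσd, hσr, hσl⟩ := exists_local_inverse_of_hasFDerivAt_smul_id
    (contDiffAt_powCoord (E := E) (G := G) 2) (by simp) (by simp) (by simp)
    (hasFDerivAt_powCoord 2)
  obtain ⟨L, hLc, hL0, hLd, hLσ⟩ := exists_linearization_of_fderiv_eq_half
    (hσc.of_le le_top) hσ0 (by rw [hσd.fderiv]; simp)
  obtain ⟨e, hec, he0, hed, her, hel⟩ := exists_local_inverse_of_hasFDerivAt_smul_id
    hLc (by simp) hL0 one_ne_zero (by simpa using hLd)
  rw [inv_one, one_smul] at hed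
  refine ⟨e, hec, he0, hed, fun m ↦ ?_⟩
  have te : Tendsto e (𝓝 0) (𝓝 0) := by simpa [he0] using hec.continuousAt.tendsto
  have tσ : Tendsto σ (𝓝 0) (𝓝 0) := by simpa [hσ0] using hσc.continuousAt.tendsto
  have tp : ∀ k, Tendsto (powCoord E G k) (𝓝 0) (𝓝 0) := fun k ↦ by
    simpa using (contDiffAt_powCoord (E := E) (G := G) k).continuousAt.tendsto
  obtain rfl | hm := eq_or_ne m 0
  · simp [he0]
  have hm' : (m : ℂ) ≠ 0 := by exact_mod_cast hm
  -- powers commute with the square root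
  have hpσ : ∀ᶠ x in 𝓝 0, powCoord E G m (σ x) = σ (powCoord E G m x) := by
    filter_upwards [tσ.eventually (eventually_par_powCoord (E := E) (G := G) m),
      (tp m |>.comp tσ).eventually hσl, hσr,
      tσ.eventually (eventually_par_powCoord (E := E) (G := G) 2)] with x h1 h2 h3 h4
    rw [h3] at h4
    rw [Function.comp_apply] at h2
    rw [← h2]
    congr 1
    rw [powCoord, h1, powCoord, h4, ← pow_mul, ← pow_mul, mul_comm]
  -- The linearization read through `e = L⁻¹`: halving corresponds to the square root.
  have heσ : ∀ᶠ y in 𝓝 0, e ((2⁻¹ : ℂ) • y) = σ (e y) := by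
    filter_upwards [her, te.eventually hLσ, (tσ.comp te).eventually hel] with y h1 h2 h3
    rw [Function.comp_apply, h2, h1] at h3
    exact h3
  -- The `m`-th power read in the linearizing coordinate and divided by `m` is tangent to the
  -- identity. It commutes with halving because powers commute with `σ`, so it is the identity.
  have hw := eventually_eq_of_commute_half
    (w := fun y ↦ (m : ℂ)⁻¹ • L (powCoord E G m (e y))) (by simp [he0, hL0]) (by
      have h1 : HasFDerivAt (fun y ↦ powCoord E G m (e y))
          (((m : ℂ) • ContinuousLinearMap.id ℂ E).comp (ContinuousLinearMap.id ℂ E)) 0 :=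
        HasFDerivAt.comp (g := powCoord E G m) (f := e) (0 : E)
            (by simpa [he0] using hasFDerivAt_powCoord (E := E) (G := G) m) hed
      have h2 : HasFDerivAt (fun y ↦ L (powCoord E G m (e y)))
          ((ContinuousLinearMap.id ℂ E).comp
            (((m : ℂ) • ContinuousLinearMap.id ℂ E).comp (ContinuousLinearMap.id ℂ E))) 0 :=
        HasFDerivAt.comp (g := L) (f := fun y ↦ powCoord E G m (e y)) (0 : E)
            (by simpa [he0] using hLd) h1
      convert! h2.const_smul (m : ℂ)⁻¹ using 1
      ext x
      simp [smul_smul, hm'])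
    (by
      filter_upwards [heσ, te.eventually hpσ, ((tp m).comp te).eventually hLσ] with y h1 h2 h3
      rw [Function.comp_apply] at h3
      rw [h1, h2, h3, smul_comm])
  filter_upwards [hw, ((tp m).comp te).eventually hel,
    te.eventually (eventually_par_powCoord (E := E) (G := G) m)] with y h1 h2 h3
  rw [Function.comp_apply] at h2
  rw [← h3, ← h2]
  congr 2
  nth_rewrite 1 [← h1]
  rw [smul_smul, mul_inv_cancel₀ hm', one_smul]

end LocalGroup

/-! ### The global exponential map. -/

section Exponential

variable {E : Type*} [NormedAddCommGroup E] [NormedSpace ℂ E]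
  {G : Type*} [TopologicalSpace G] [ChartedSpace E G] [Group G] [LieGroup 𝓘(ℂ, E) ω G]

/-- The exponential map at the identity, obtained from its germ by repeated doubling. -/
theorem exists_lieExp [CompleteSpace E] : ∃ Exp : E → G,
    (∃ e : E → E, ContDiffAt ℂ 1 e 0 ∧ e 0 = 0 ∧ HasFDerivAt e (ContinuousLinearMap.id ℂ E) 0 ∧
      ∀ᶠ x in 𝓝 0, Exp x = par G (e x)) ∧
    (∀ (m : ℕ) (x : E), Exp ((m : ℂ) • x) = Exp x ^ m) ∧
    ∀ x, MDifferentiableAt 𝓘(ℂ, E) 𝓘(ℂ, E) Exp x := by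
  classical
  obtain ⟨e, hec, he0, hed, hem⟩ := exists_expGerm (E := E) (G := G)
  set P : E → G := fun x ↦ par G (e x) with hP
  have hPd : ∀ᶠ x in 𝓝 0, MDifferentiableAt 𝓘(ℂ, E) 𝓘(ℂ, E) P x := by
    have te : Tendsto e (𝓝 0) (𝓝 0) := by simpa [he0] using hec.continuousAt.tendsto
    filter_upwards [te.eventually (eventually_contMDiffAt_par (E := E) (G := G)),
      hec.eventually (by simp)] with x h1 h2
    exact (h1.mdifferentiableAt (by simp)).comp x
      (h2.differentiableAt (by simp)).mdifferentiableAt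
  obtain ⟨r, hr, hball⟩ := Metric.eventually_nhds_iff_ball.1 ((hem 2).and hPd)
  have hhalf : ∀ x : E, Tendsto (fun k : ℕ ↦ (2⁻¹ : ℂ) ^ k • x) atTop (𝓝 0) := by
    intro x
    have h : Tendsto (fun k : ℕ ↦ (2⁻¹ : ℂ) ^ k) atTop (𝓝 0) :=
      tendsto_pow_atTop_nhds_zero_of_norm_lt_one (by norm_num)
    simpa using h.smul_const x
  have hex : ∀ x : E, ∃ k : ℕ, (2⁻¹ : ℂ) ^ k • x ∈ Metric.ball (0 : E) r := fun x ↦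
    ((hhalf x).eventually (Metric.ball_mem_nhds _ hr)).exists
  -- Once `2^{-k} x` lies in the ball, further halvings do not change `P(2^{-k} x)^(2^k)`; hence the
  -- choice of `k` in `Exp` does not matter, and one `k` serves a whole neighbourhood.
  have hstep : ∀ (x : E) (k j : ℕ), k ≤ j → (2⁻¹ : ℂ) ^ k • x ∈ Metric.ball (0 : E) r →
      (2⁻¹ : ℂ) ^ j • x ∈ Metric.ball (0 : E) r ∧
      P ((2⁻¹ : ℂ) ^ j • x) ^ 2 ^ j = P ((2⁻¹ : ℂ) ^ k • x) ^ 2 ^ k := by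
    intro x k j hkj hk
    induction j, hkj using Nat.le_induction with
    | base => exact ⟨hk, rfl⟩
    | succ j _ ih =>
      have hmem : (2⁻¹ : ℂ) ^ (j + 1) • x ∈ Metric.ball (0 : E) r := by
        have h := ih.1
        rw [mem_ball_zero_iff] at h ⊢
        rw [pow_succ', mul_smul, norm_smul]
        refine lt_of_le_of_lt (mul_le_of_le_one_left (norm_nonneg _) ?_) h
        norm_num
      refine ⟨hmem, ?_⟩
      have h2 := (hball _ hmem).1
      have h3 : ((2 : ℕ) : ℂ) • (2⁻¹ : ℂ) ^ (j + 1) • x = (2⁻¹ : ℂ) ^ j • x := by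
        rw [smul_smul, pow_succ', ← mul_assoc]
        norm_num
      rw [h3] at h2
      rw [← ih.2, hP]
      beta_reduce
      rw [h2, ← pow_mul, pow_succ' 2 j]
  set Exp : E → G := fun x ↦ P ((2⁻¹ : ℂ) ^ Nat.find (hex x) • x) ^ 2 ^ Nat.find (hex x)
    with hExp
  have hE : ∀ (x : E) (k : ℕ), (2⁻¹ : ℂ) ^ k • x ∈ Metric.ball (0 : E) r →
      Exp x = P ((2⁻¹ : ℂ) ^ k • x) ^ 2 ^ k := fun x k hk ↦
    (hstep x _ k (Nat.find_min' (hex x) hk) (Nat.find_spec (hex x))).2.symm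
  refine ⟨Exp, ⟨e, hec, he0, hed, ?_⟩, ?_, ?_⟩
  · filter_upwards [Metric.ball_mem_nhds (0 : E) hr] with x hx
    simpa using hE x 0 (by simpa using hx)
  · intro m x
    obtain ⟨k, ⟨h1, h2⟩, h3⟩ := (((hhalf x).eventually (Metric.ball_mem_nhds _ hr)).and
      ((hhalf ((m : ℂ) • x)).eventually (Metric.ball_mem_nhds _ hr))|>.and
      ((hhalf x).eventually (hem m))).exists
    rw [hE _ k h1, hE _ k h2, smul_comm, hP]
    beta_reduce
    rw [h3, ← pow_mul, ← pow_mul, mul_comm]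
  · intro x
    obtain ⟨k, hk⟩ := hex x
    have hc : ContinuousAt (fun y : E ↦ (2⁻¹ : ℂ) ^ k • y) x := by fun_prop
    have heq : Exp =ᶠ[𝓝 x] fun y ↦ P ((2⁻¹ : ℂ) ^ k • y) ^ 2 ^ k := by
      filter_upwards [hc.eventually (Metric.isOpen_ball.mem_nhds hk)] with y hy using hE y k hy
    refine MDifferentiableAt.congr_of_eventuallyEq ?_ heq
    have h1 : MDifferentiableAt 𝓘(ℂ, E) 𝓘(ℂ, E) (fun y : E ↦ P ((2⁻¹ : ℂ) ^ k • y)) x :=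
      MDifferentiableAt.comp (g := P) (f := fun y : E ↦ (2⁻¹ : ℂ) ^ k • y) x (hball _ hk).2
        (DifferentiableAt.mdifferentiableAt (by fun_prop))
    exact ((contMDiff_pow (I := 𝓘(ℂ, E)) (n := ω) (G := G) (2 ^ k)).contMDiffAt.mdifferentiableAt
      (by simp)).comp x h1

variable [CompleteSpace E]

variable (E G) in
/-- The exponential map of the group at the identity. -/
def lieExp : E → G := (exists_lieExp (E := E) (G := G)).choose

theorem lieExp_eventually_eq_par : ∃ e : E → E, ContDiffAt ℂ 1 e 0 ∧ e 0 = 0 ∧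
    HasFDerivAt e (ContinuousLinearMap.id ℂ E) 0 ∧ ∀ᶠ x in 𝓝 0, lieExp E G x = par G (e x) :=
  (exists_lieExp (E := E) (G := G)).choose_spec.1

theorem lieExp_nat_smul (m : ℕ) (x : E) : lieExp E G ((m : ℂ) • x) = lieExp E G x ^ m :=
  (exists_lieExp (E := E) (G := G)).choose_spec.2.1 m x

theorem mdifferentiableAt_lieExp (x : E) :
    MDifferentiableAt 𝓘(ℂ, E) 𝓘(ℂ, E) (lieExp E G) x :=
  (exists_lieExp (E := E) (G := G)).choose_spec.2.2 x

@[simp] theorem lieExp_zero : lieExp E G 0 = 1 := by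
  simpa using lieExp_nat_smul (G := G) 0 (0 : E)

/-- Both sides are powers of `Exp(x/n)`. Additivity along these increments is enough to compute a
derivative in the direction `x`, since a derivative already known to exist can be tested on the
sequence `x/n`. -/
theorem lieExp_add_smul_inv (x : E) {n : ℕ} (hn : n ≠ 0) :
    lieExp E G (x + (n : ℂ)⁻¹ • x) = lieExp E G x * lieExp E G ((n : ℂ)⁻¹ • x) := by
  have hn' : (n : ℂ) ≠ 0 := by exact_mod_cast hn
  have h1 := lieExp_nat_smul (G := G) (n + 1) ((n : ℂ)⁻¹ • x)
  have h2 := lieExp_nat_smul (G := G) n ((n : ℂ)⁻¹ • x)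
  rw [smul_inv_smul₀ hn'] at h2
  rw [h2, ← pow_succ, ← h1]
  congr 1
  push_cast
  rw [add_smul, one_smul, smul_inv_smul₀ hn']

theorem commute_lieExp (x : E) {n : ℕ} (hn : n ≠ 0) :
    Commute (lieExp E G x) (lieExp E G ((n : ℂ)⁻¹ • x)) := by
  have hn' : (n : ℂ) ≠ 0 := by exact_mod_cast hn
  have h2 := lieExp_nat_smul (G := G) n ((n : ℂ)⁻¹ • x)
  rw [smul_inv_smul₀ hn'] at h2
  rw [h2]
  exact (Commute.refl _).pow_left n

theorem hasFDerivAt_coord_lieExp :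
    HasFDerivAt (fun x ↦ coord E (lieExp E G x)) (ContinuousLinearMap.id ℂ E) 0 := by
  obtain ⟨e, hec, he0, hed, he⟩ := lieExp_eventually_eq_par (E := E) (G := G)
  have te : Tendsto e (𝓝 0) (𝓝 0) := by simpa [he0] using hec.continuousAt.tendsto
  refine hed.congr_of_eventuallyEq ?_
  filter_upwards [he, te.eventually (eventually_coord_par (E := E) (G := G))] with x h1 h2
  rw [h1, h2]

end Exponential

/-! ### The left logarithmic derivative and the adjoint action. -/

section LeftDerivative

variable {E : Type*} [NormedAddCommGroup E] [NormedSpace ℂ E]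
  {G : Type*} [TopologicalSpace G] [ChartedSpace E G] [Group G]
  {F : Type*} [NormedAddCommGroup F] [NormedSpace ℂ F]

/-- The left logarithmic derivative of a map `f` into the group, with values in the Lie algebra. -/
def leftDeriv (f : F → G) (x : F) : F →L[ℂ] E :=
  fderiv ℂ (fun y ↦ coord E ((f x)⁻¹ * f y)) x

/-- The adjoint action of `a` on the Lie algebra. -/
def adjoint (a : G) : E →L[ℂ] E := fderiv ℂ (fun y ↦ coord E (a * par G y * a⁻¹)) 0

theorem leftDeriv_const_mul (k : G) (f : F → G) (x : F) :
    leftDeriv (E := E) (fun y ↦ k * f y) x = leftDeriv f x := by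
  simp only [leftDeriv]
  congr 1
  ext y
  congr 1
  group

variable [LieGroup 𝓘(ℂ, E) ω G]

theorem mdifferentiable_mulLeft (a : G) : MDifferentiable 𝓘(ℂ, E) 𝓘(ℂ, E) (fun x : G ↦ a * x) :=
  (contMDiff_mul_left (I := 𝓘(ℂ, E)) (n := ω)).mdifferentiable (by simp)

variable (E) in
/-- The differential of the left translation by `a` at `g`, as an endomorphism of the model
space. -/
def mulLeftDeriv (a g : G) : E →L[ℂ] E := mfderiv 𝓘(ℂ, E) 𝓘(ℂ, E) (fun y : G ↦ a * y) g

theorem hasMFDerivAt_mulLeft (a g : G) :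
    HasMFDerivAt 𝓘(ℂ, E) 𝓘(ℂ, E) (fun y : G ↦ a * y) g (mulLeftDeriv E a g) :=
  (mdifferentiable_mulLeft a g).hasMFDerivAt

theorem differentiableAt_coord_comp {f : F → G} {x : F}
    (hf : MDifferentiableAt 𝓘(ℂ, F) 𝓘(ℂ, E) f x) (hx : f x = 1) :
    DifferentiableAt ℂ (fun y ↦ coord E (f y)) x := by
  have h : MDifferentiableAt 𝓘(ℂ, E) 𝓘(ℂ, E) (coord E) (f x) := by
    rw [hx]; exact contMDiffAt_coord.mdifferentiableAt (by simp)
  exact (h.comp x hf).differentiableAt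

theorem hasFDerivAt_leftDeriv {f : F → G} {x : F}
    (hf : MDifferentiableAt 𝓘(ℂ, F) 𝓘(ℂ, E) f x) :
    HasFDerivAt (fun y ↦ coord E ((f x)⁻¹ * f y)) (leftDeriv f x) x :=
  (differentiableAt_coord_comp (f := fun y ↦ (f x)⁻¹ * f y)
    ((mdifferentiable_mulLeft _ _).comp x hf) (by simp)).hasFDerivAt

theorem eventually_eq_mul_par {F : Type*} [TopologicalSpace F] {f : F → G} {x : F}
    (hf : ContinuousAt f x) :
    ∀ᶠ y in 𝓝 x, par G (coord E ((f x)⁻¹ * f y)) = (f x)⁻¹ * f y := by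
  have h : ContinuousAt (fun y ↦ (f x)⁻¹ * f y) x :=
    ((mdifferentiable_mulLeft (E := E) (f x)⁻¹).continuous.continuousAt).comp hf
  exact h.tendsto.eventually (by simpa using eventually_par_coord (E := E) (G := G))

/-- The differential of a `G`-valued map is the left translate of its left derivative. -/
theorem hasMFDerivAt_of_leftDeriv {f : F → G} {x : F}
    (hf : MDifferentiableAt 𝓘(ℂ, F) 𝓘(ℂ, E) f x) :
    HasMFDerivAt 𝓘(ℂ, F) 𝓘(ℂ, E) f x
      ((mulLeftDeriv E (f x) 1).comp (leftDeriv (E := E) (F := F) f x)) := by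
  set α : F → E := fun y ↦ coord E ((f x)⁻¹ * f y) with hα
  have hα0 : α x = 0 := by simp [hα]
  have h1 : HasMFDerivAt 𝓘(ℂ, F) 𝓘(ℂ, E) α x (leftDeriv (E := E) (F := F) f x) :=
    (hasFDerivAt_leftDeriv hf).hasMFDerivAt
  have h2 : HasMFDerivAt 𝓘(ℂ, E) 𝓘(ℂ, E) (par G) (α x) (ContinuousLinearMap.id ℂ E) := by
    rw [hα0]; exact hasMFDerivAt_par
  have h3 : HasMFDerivAt 𝓘(ℂ, E) 𝓘(ℂ, E) (fun y : G ↦ f x * y) (par G (α x))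
      (mulLeftDeriv E (f x) 1) := by
    rw [hα0, par_zero]; exact hasMFDerivAt_mulLeft (f x) 1
  have h4 := h3.comp x (h2.comp x h1)
  refine HasMFDerivAt.congr_of_eventuallyEq h4 ?_
  filter_upwards [eventually_eq_mul_par (E := E) hf.continuousAt] with y hy
  simp [hα, hy]

theorem leftDeriv_eq_of_hasMFDerivAt {f : F → G} {x : F} {A : F →L[ℂ] E}
    (hf : HasMFDerivAt 𝓘(ℂ, F) 𝓘(ℂ, E) f x
      ((mulLeftDeriv E (f x) 1).comp A)) :
    leftDeriv f x = A := by
  have h1 := (hasMFDerivAt_of_leftDeriv hf.mdifferentiableAt)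
  have h2 := hasMFDerivAt_unique hf h1
  -- Translation by `(f x)⁻¹` undoes translation by `f x`, so the differential of the latter can be
  -- cancelled.
  have hinv : (mulLeftDeriv E (f x)⁻¹ (f x * 1)).comp (mulLeftDeriv E (f x) 1)
      = ContinuousLinearMap.id ℂ E := by
    have h3 := (hasMFDerivAt_mulLeft (E := E) (f x)⁻¹ (f x * 1)).comp 1
      (hasMFDerivAt_mulLeft (E := E) (f x) 1)
    have h4 : HasMFDerivAt 𝓘(ℂ, E) 𝓘(ℂ, E)
        ((fun y : G ↦ (f x)⁻¹ * y) ∘ (fun y : G ↦ f x * y)) 1 (ContinuousLinearMap.id ℂ E) := by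
      have : ((fun y : G ↦ (f x)⁻¹ * y) ∘ (fun y : G ↦ f x * y)) = id := by ext y; simp
      rw [this]; exact hasMFDerivAt_id 1
    exact hasMFDerivAt_unique h3 h4
  have h5 : (ContinuousLinearMap.id ℂ E).comp A = (ContinuousLinearMap.id ℂ E).comp
      (leftDeriv f x) := by
    rw [← hinv, ContinuousLinearMap.comp_assoc, ContinuousLinearMap.comp_assoc]
    exact congrArg _ h2
  simpa using h5.symm

theorem leftDeriv_comp_clm {F' : Type*} [NormedAddCommGroup F'] [NormedSpace ℂ F'] {f : F → G}
    (T : F' →L[ℂ] F) {x : F'} (hf : MDifferentiableAt 𝓘(ℂ, F) 𝓘(ℂ, E) f (T x)) :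
    leftDeriv (E := E) (fun y ↦ f (T y)) x = (leftDeriv f (T x)).comp T :=
  ((hasFDerivAt_leftDeriv hf).comp x T.hasFDerivAt).fderiv

theorem contDiffAt_conj (a : G) :
    ContDiffAt ℂ ω (fun y : E ↦ coord E (a * par G y * a⁻¹)) 0 := by
  refine contDiffAt_coord_comp (f := fun y : E ↦ a * par G y * a⁻¹) ?_ (by simp)
  exact ((contMDiff_mul_right (I := 𝓘(ℂ, E)) (n := ω) (a := a⁻¹)).comp
    (contMDiff_mul_left (I := 𝓘(ℂ, E)) (n := ω) (a := a))).contMDiffAt.comp (0 : E) contMDiffAt_par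

theorem hasFDerivAt_conj (a : G) :
    HasFDerivAt (fun y : E ↦ coord E (a * par G y * a⁻¹)) (adjoint a) 0 :=
  ((contDiffAt_conj a).differentiableAt (by simp)).hasFDerivAt

theorem eventually_par_conj (a : G) :
    ∀ᶠ y in 𝓝 (0 : E), par G (coord E (a * par G y * a⁻¹)) = a * par G y * a⁻¹ := by
  have h : ContinuousAt (fun y : E ↦ a * par G y * a⁻¹) 0 :=
    (((contMDiff_mul_right (I := 𝓘(ℂ, E)) (n := ω) (a := a⁻¹)).comp
      (contMDiff_mul_left (I := 𝓘(ℂ, E)) (n := ω) (a := a))).continuous.continuousAt).comp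
      continuousAt_par
  exact h.tendsto.eventually (by simpa using eventually_par_coord (E := E) (G := G))

/-- The product rule for left derivatives. -/
theorem leftDeriv_mul {f g : F → G} {x : F}
    (hf : MDifferentiableAt 𝓘(ℂ, F) 𝓘(ℂ, E) f x) (hg : MDifferentiableAt 𝓘(ℂ, F) 𝓘(ℂ, E) g x) :
    leftDeriv (fun y ↦ f y * g y) x =
      (adjoint (g x)⁻¹).comp (leftDeriv (E := E) f x) + leftDeriv g x := by
  have h1 := hasFDerivAt_leftDeriv hf
  have h2 := hasFDerivAt_leftDeriv hg
  -- The factorization used is `(f x g x)⁻¹ (f y g y) = [g(x)⁻¹ (f(x)⁻¹ f y) g x] · [g(x)⁻¹ g y]`.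
  -- At the identity the derivative of a product is the sum of the derivatives.
  have h3 : HasFDerivAt (fun y ↦ coord E ((g x)⁻¹ * par G (coord E ((f x)⁻¹ * f y)) * (g x)⁻¹⁻¹))
      ((adjoint (g x)⁻¹).comp (leftDeriv (E := E) f x)) x :=
    HasFDerivAt.comp (g := fun y ↦ coord E ((g x)⁻¹ * par G y * (g x)⁻¹⁻¹)) x
      (by simpa using hasFDerivAt_conj (E := E) (g x)⁻¹) h1
  have h4 : HasFDerivAt (fun y ↦ mulCoord E G
      (coord E ((g x)⁻¹ * par G (coord E ((f x)⁻¹ * f y)) * (g x)⁻¹⁻¹),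
        coord E ((g x)⁻¹ * g y)))
      ((ContinuousLinearMap.fst ℂ E E + ContinuousLinearMap.snd ℂ E E).comp
        (((adjoint (g x)⁻¹).comp (leftDeriv (E := E) f x)).prod (leftDeriv g x))) x := by
    refine HasFDerivAt.comp (g := mulCoord E G)
      (f := fun y ↦ (coord E ((g x)⁻¹ * par G (coord E ((f x)⁻¹ * f y)) * (g x)⁻¹⁻¹),
        coord E ((g x)⁻¹ * g y))) x ?_ (h3.prodMk h2)
    have h0 : ((coord E ((g x)⁻¹ * par G (coord E ((f x)⁻¹ * f x)) * (g x)⁻¹⁻¹),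
        coord E ((g x)⁻¹ * g x)) : E × E) = 0 := by simp
    rw [h0]
    exact hasFDerivAt_mulCoord
  have h5 := by
    refine h4.congr_of_eventuallyEq
      (f₁ := fun y ↦ coord E ((f x * g x)⁻¹ * (f y * g y))) ?_
    have hc : Tendsto (fun y ↦ coord E ((f x)⁻¹ * f y)) (𝓝 x) (𝓝 0) := by
      simpa using h1.continuousAt.tendsto
    filter_upwards [eventually_eq_mul_par (E := E) hf.continuousAt,
      eventually_eq_mul_par (E := E) hg.continuousAt,
      hc.eventually (eventually_par_conj (E := E) (g x)⁻¹)] with y e1 e2 e3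
    rw [mulCoord, e3, e2, e1]
    congr 1
    group
  rw [leftDeriv, h5.fderiv]
  ext v
  simp

/-- A map with vanishing left derivative is locally constant. -/
theorem isLocallyConstant_of_leftDeriv_eq_zero {f : F → G}
    (hf : MDifferentiable 𝓘(ℂ, F) 𝓘(ℂ, E) f) (h0 : ∀ x, leftDeriv (E := E) f x = 0) :
    IsLocallyConstant f := by
  rw [IsLocallyConstant.iff_eventually_eq]
  intro x
  have hm : ∀ y, HasMFDerivAt 𝓘(ℂ, F) 𝓘(ℂ, E) f y (0 : F →L[ℂ] E) := by
    intro y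
    have h1 : (mulLeftDeriv E (f y) 1).comp (leftDeriv (E := E) (F := F) f y) =
        (0 : F →L[ℂ] E) := by rw [h0, ContinuousLinearMap.comp_zero]
    exact (congrArg (fun A : F →L[ℂ] E ↦ HasMFDerivAt 𝓘(ℂ, F) 𝓘(ℂ, E) f y A) h1).mp
      (hasMFDerivAt_of_leftDeriv (hf y))
  have hc : ContinuousAt (fun y ↦ (f x)⁻¹ * f y) x :=
    ((mdifferentiable_mulLeft (E := E) (f x)⁻¹).continuous.continuousAt).comp (hf x).continuousAt
  have hd : ∀ᶠ y in 𝓝 x, HasFDerivAt (fun y ↦ coord E ((f x)⁻¹ * f y)) (0 : F →L[ℂ] E) y := by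
    have := hc.tendsto.eventually (p := fun k ↦ ContMDiffAt 𝓘(ℂ, E) 𝓘(ℂ, E) ω (coord E) k)
      (by simpa using eventually_contMDiffAt_coord (E := E) (G := G))
    filter_upwards [this] with y hy
    have h1 := (hasMFDerivAt_mulLeft (E := E) (f x)⁻¹ (f y)).comp y (hm y)
    obtain ⟨A, hA⟩ : ∃ A : E →L[ℂ] E, HasMFDerivAt 𝓘(ℂ, E) 𝓘(ℂ, E) (coord E) ((f x)⁻¹ * f y) A :=
      ⟨_, (hy.mdifferentiableAt (by simp)).hasMFDerivAt⟩
    have h3 : HasFDerivAt (fun y ↦ coord E ((f x)⁻¹ * f y))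
        (A.comp ((mulLeftDeriv E (f x)⁻¹ (f y)).comp (0 : F →L[ℂ] E))) y :=
      hasMFDerivAt_iff_hasFDerivAt.1 (hA.comp y h1)
    simpa using h3
  obtain ⟨r, hr, hball⟩ := Metric.eventually_nhds_iff_ball.1
    (hd.and (eventually_eq_mul_par (E := E) (hf x).continuousAt))
  filter_upwards [Metric.ball_mem_nhds x hr] with y hy
  have hconst := Metric.isOpen_ball.is_const_of_fderiv_eq_zero (𝕜 := ℂ)
    (convex_ball x r).isPreconnected
    (fun z hz ↦ (hball z hz).1.differentiableAt.differentiableWithinAt)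
    (fun z hz ↦ (hball z hz).1.fderiv) hy (Metric.mem_ball_self hr)
  have e1 := (hball y hy).2
  beta_reduce at hconst
  rw [hconst] at e1
  simp only [inv_mul_cancel, coord_one, par_zero] at e1
  exact (inv_mul_eq_one.1 e1.symm).symm

end LeftDerivative

/-! ### Existence and uniqueness of the integral curves. -/

section ExpCurve

variable {E : Type*} [NormedAddCommGroup E] [NormedSpace ℂ E]
  {G : Type*} [TopologicalSpace G] [ChartedSpace E G] [Group G] [LieGroup 𝓘(ℂ, E) ω G]

theorem tendsto_norm_natCast_atTop : Tendsto (fun n : ℕ ↦ ‖(n : ℂ)‖) atTop atTop := by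
  simpa using tendsto_natCast_atTop_atTop (R := ℝ)

theorem tendsto_natCast_inv_smul (x : E) : Tendsto (fun n : ℕ ↦ (n : ℂ)⁻¹ • x) atTop (𝓝 0) := by
  have h : Tendsto (fun n : ℕ ↦ (n : ℂ)⁻¹) atTop (𝓝 0) :=
    tendsto_inv_atTop_nhds_zero_nat (𝕜 := ℂ)
  simpa using h.smul_const x

/-- Translating the equation back to the identity turns the left-invariant field into a constant
vector. -/
theorem isExpCurve_iff {g : G} {ξ : TangentSpace 𝓘(ℂ, E) g} {γ : ℂ → G} :
    IsExpCurve g ξ γ ↔ γ 0 = g ∧ MDifferentiable 𝓘(ℂ, ℂ) 𝓘(ℂ, E) γ ∧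
      ∀ z, leftDeriv γ z = (1 : ℂ →L[ℂ] ℂ).smulRight (mulLeftDeriv E g⁻¹ g ξ) := by
  have hsmul : ∀ z, (mulLeftDeriv E (γ z) 1).comp
      ((1 : ℂ →L[ℂ] ℂ).smulRight (mulLeftDeriv E g⁻¹ g ξ)) =
      (1 : ℂ →L[ℂ] ℂ).smulRight (mulLeftDeriv E (γ z) 1 (mulLeftDeriv E g⁻¹ g ξ)) := by
    intro z; ext; simp
  have key : ∀ z, HasMFDerivAt 𝓘(ℂ, ℂ) 𝓘(ℂ, E) γ z
      ((1 : ℂ →L[ℂ] ℂ).smulRight (leftInvariantField g ξ (γ z))) ↔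
      HasMFDerivAt 𝓘(ℂ, ℂ) 𝓘(ℂ, E) γ z ((mulLeftDeriv E (γ z) 1).comp
        ((1 : ℂ →L[ℂ] ℂ).smulRight (mulLeftDeriv E g⁻¹ g ξ))) := fun z ↦
    (congrArg (fun A : ℂ →L[ℂ] E ↦ HasMFDerivAt 𝓘(ℂ, ℂ) 𝓘(ℂ, E) γ z A) (hsmul z)).to_iff.symm
  constructor
  · rintro ⟨h0, h⟩
    exact ⟨h0, fun z ↦ (h z).mdifferentiableAt,
      fun z ↦ leftDeriv_eq_of_hasMFDerivAt ((key z).1 (h z))⟩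
  · rintro ⟨h0, hd, h⟩
    refine ⟨h0, fun z ↦ (key z).2 ?_⟩
    rw [← h z]
    exact hasMFDerivAt_of_leftDeriv (hd z)

/-- The linear curve `z ↦ z • x`. -/
def lineMap (x : E) : ℂ →L[ℂ] E := (1 : ℂ →L[ℂ] ℂ).smulRight x

@[simp] theorem lineMap_apply (x : E) (z : ℂ) : lineMap x z = z • x := rfl

variable [CompleteSpace E]

theorem leftDeriv_lieExp_zero :
    leftDeriv (lieExp E G) (0 : E) = ContinuousLinearMap.id ℂ E := by
  rw [leftDeriv, ← (hasFDerivAt_coord_lieExp (G := G)).fderiv]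
  simp

theorem leftDeriv_lieExp_self (x : E) : leftDeriv (lieExp E G) x x = x := by
  have h1 := (hasFDerivAt_leftDeriv (mdifferentiableAt_lieExp (G := G) x)).lim x
    tendsto_norm_natCast_atTop
  have h2 := (hasFDerivAt_coord_lieExp (E := E) (G := G)).lim x tendsto_norm_natCast_atTop
  refine tendsto_nhds_unique_of_eventuallyEq h1 h2 ?_
  filter_upwards [eventually_ne_atTop 0] with n hn
  simp [lieExp_add_smul_inv x hn]

/-- `Ad(a) x` is the limit of `n` times the coordinates of `a Exp(x/n) a⁻¹ = Exp(x/n)`. -/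
theorem adjoint_apply_eq_self_of_commute {a : G} {x : E}
    (h : ∀ n : ℕ, n ≠ 0 → Commute a (lieExp E G ((n : ℂ)⁻¹ • x))) : adjoint a x = x := by
  have h0 : HasFDerivAt (fun y ↦ coord E (a * par G (coord E (lieExp E G y)) * a⁻¹))
      ((adjoint a).comp (ContinuousLinearMap.id ℂ E)) 0 :=
    HasFDerivAt.comp (g := fun y ↦ coord E (a * par G y * a⁻¹)) (0 : E)
      (by simpa using hasFDerivAt_conj (E := E) a) hasFDerivAt_coord_lieExp
  have h1 := h0.lim x tendsto_norm_natCast_atTop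
  have h2 := (hasFDerivAt_coord_lieExp (E := E) (G := G)).lim x tendsto_norm_natCast_atTop
  refine tendsto_nhds_unique_of_eventuallyEq h1 h2 ?_
  have hc : Tendsto (lieExp E G) (𝓝 0) (𝓝 1) := by
    simpa using (mdifferentiableAt_lieExp (G := G) (0 : E)).continuousAt.tendsto
  filter_upwards [eventually_ne_atTop 0, (hc.comp (tendsto_natCast_inv_smul x)).eventually
    (eventually_par_coord (E := E))] with n hn hpar
  simp only [Function.comp_apply] at hpar
  simp only [zero_add, lieExp_zero, coord_one, par_zero, mul_one, mul_inv_cancel, sub_zero]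
  rw [hpar, (h n hn).eq, mul_inv_cancel_right]

theorem mdifferentiable_lieExp_lineMap (x : E) :
    MDifferentiable 𝓘(ℂ, ℂ) 𝓘(ℂ, E) (fun z ↦ lieExp E G (lineMap x z)) := fun z ↦
  (mdifferentiableAt_lieExp _).comp z (lineMap x).differentiableAt.mdifferentiableAt

theorem leftDeriv_lieExp_lineMap (x : E) (z : ℂ) :
    leftDeriv (fun z ↦ lieExp E G (lineMap x z)) z = lineMap x := by
  rw [leftDeriv_comp_clm _ (mdifferentiableAt_lieExp _)]
  -- The derivative at `z x` fixes `z x`, hence `x` after division by `z`; at `z = 0` the derivative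
  -- is the identity.
  ext
  obtain rfl | hz := eq_or_ne z 0
  · simp [leftDeriv_lieExp_zero]
  · have h := leftDeriv_lieExp_self (G := G) (z • x)
    rw [map_smul] at h
    simpa using smul_right_injective E hz h

/-- The product `γ(z) Exp(-zx)` has left derivative `Ad(Exp(-zx)⁻¹) x - x = 0`, so it is constant.
The inverse of `Exp(-zx)` stays in the formula because `lieExp_neg` is itself deduced from it. -/
theorem eq_mul_inv_lieExp_of_leftDeriv {γ : ℂ → G} {x : E}
    (hγ : MDifferentiable 𝓘(ℂ, ℂ) 𝓘(ℂ, E) γ) (h : ∀ z, leftDeriv γ z = lineMap x) (z : ℂ) :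
    γ z = γ 0 * (lieExp E G (lineMap (-x) z))⁻¹ := by
  have hmd : MDifferentiable 𝓘(ℂ, ℂ) 𝓘(ℂ, E) (fun z ↦ γ z * lieExp E G (lineMap (-x) z)) :=
    fun z ↦ by
      have h1 := ((contMDiff_mul 𝓘(ℂ, E) ω (G := G)).mdifferentiable (by simp)
        (γ z, lieExp E G (lineMap (-x) z))).comp z
        ((hγ z).prodMk (mdifferentiable_lieExp_lineMap (G := G) (-x) z))
      exact h1
  have h0 : ∀ z, leftDeriv (E := E) (fun z ↦ γ z * lieExp E G (lineMap (-x) z)) z = 0 := by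
    intro z
    rw [leftDeriv_mul (hγ z) (mdifferentiable_lieExp_lineMap (-x) z), h,
      leftDeriv_lieExp_lineMap]
    have hx : adjoint (lieExp E G (lineMap (-x) z))⁻¹ x = x := by
      obtain rfl | hz := eq_or_ne z 0
      · refine adjoint_apply_eq_self_of_commute fun n hn ↦ ?_
        simp
      · have h1 : adjoint (lieExp E G (lineMap (-x) z))⁻¹ (lineMap (-x) z) = lineMap (-x) z :=
          adjoint_apply_eq_self_of_commute fun n hn ↦ (commute_lieExp _ hn).inv_left
        rw [lineMap_apply, map_smul, map_neg] at h1
        exact neg_injective (smul_right_injective E hz h1)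
    ext
    simpa [← sub_eq_add_neg, sub_eq_zero] using hx
  have := (isLocallyConstant_of_leftDeriv_eq_zero hmd h0).apply_eq_of_isPreconnected
    isPreconnected_univ (Set.mem_univ z) (Set.mem_univ 0)
  rw [eq_mul_inv_iff_mul_eq]
  simpa using this

theorem lieExp_neg (x : E) : lieExp E G (-x) = (lieExp E G x)⁻¹ := by
  have := eq_mul_inv_lieExp_of_leftDeriv (mdifferentiable_lieExp_lineMap (G := G) (-x))
    (leftDeriv_lieExp_lineMap (G := G) (-x)) 1
  simpa using this

theorem isExpCurve_lieExp (g : G) (ξ : TangentSpace 𝓘(ℂ, E) g) :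
    IsExpCurve g ξ (fun z ↦ g * lieExp E G (lineMap (mulLeftDeriv E g⁻¹ g ξ) z)) := by
  refine isExpCurve_iff.2 ⟨by simp, fun z ↦ ?_, fun z ↦ ?_⟩
  · exact (mdifferentiable_mulLeft g _).comp z (mdifferentiable_lieExp_lineMap _ z)
  · rw [leftDeriv_const_mul, leftDeriv_lieExp_lineMap]
    rfl

theorem IsExpCurve.eq_lieExp {g : G} {ξ : TangentSpace 𝓘(ℂ, E) g} {γ : ℂ → G}
    (h : IsExpCurve g ξ γ) :
    γ = fun z ↦ g * lieExp E G (lineMap (mulLeftDeriv E g⁻¹ g ξ) z) := by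
  obtain ⟨h0, hd, hl⟩ := isExpCurve_iff.1 h
  ext z
  rw [eq_mul_inv_lieExp_of_leftDeriv hd hl z, h0, ← lieExp_neg]
  simp

theorem existsUnique_isExpCurve (g : G) (ξ : TangentSpace 𝓘(ℂ, E) g) :
    ∃! γ : ℂ → G, IsExpCurve g ξ γ :=
  ⟨_, isExpCurve_lieExp g ξ, fun _ h ↦ h.eq_lieExp⟩

theorem expAt_eq (g : G) (ξ : TangentSpace 𝓘(ℂ, E) g) :
    expAt g ξ = g * lieExp E G (mulLeftDeriv E g⁻¹ g ξ) := by
  have H : ∃ γ : ℂ → G, IsExpCurve g ξ γ := ⟨_, isExpCurve_lieExp g ξ⟩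
  rw [expAt, dif_pos H, H.choose_spec.eq_lieExp]
  simp

theorem expMap_eq (g : G) :
    expMap E g = fun ξ ↦ g * lieExp E G (mulLeftDeriv E g⁻¹ g ξ) :=
  funext fun ξ ↦ expAt_eq g ξ

theorem mdifferentiableAt_expMap (g : G) (ξ : E) :
    MDifferentiableAt 𝓘(ℂ, E) 𝓘(ℂ, E) (expMap E g) ξ := by
  rw [expMap_eq]
  exact (mdifferentiable_mulLeft g _).comp ξ ((mdifferentiableAt_lieExp _).comp ξ
    (mulLeftDeriv E g⁻¹ g).differentiableAt.mdifferentiableAt)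

theorem leftDeriv_expMap (g : G) (ξ : E) :
    leftDeriv (E := E) (expMap E g) ξ =
      (leftDeriv (E := E) (lieExp E G) (mulLeftDeriv E g⁻¹ g ξ)).comp (mulLeftDeriv E g⁻¹ g) := by
  rw [expMap_eq, leftDeriv_const_mul (E := E), leftDeriv_comp_clm _ (mdifferentiableAt_lieExp _)]

theorem dexpAt_apply (g : G) (ξ η : E) :
    dexpAt (E := E) g ξ η = mulLeftDeriv E (expAt g ξ) 1
      (leftDeriv (lieExp E G) (mulLeftDeriv E g⁻¹ g ξ) (mulLeftDeriv E g⁻¹ g η)) := by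
  have h := (hasMFDerivAt_of_leftDeriv (mdifferentiableAt_expMap g ξ)).mfderiv
  have h2 := leftDeriv_expMap g ξ
  have h3 : dexpAt (E := E) g ξ η = mulLeftDeriv E (expAt g ξ) 1 (leftDeriv (expMap E g) ξ η) :=
    congrArg (fun A : E →L[ℂ] E ↦ A η) h
  rw [h3, h2]
  rfl

end ExpCurve

/-! ### Second derivatives of maps of two variables. -/

section PartialDerivatives

variable {E : Type*} [NormedAddCommGroup E]

theorem tendsto_prodMk_zero_right : Tendsto (fun x : E ↦ (x, (0 : E))) (𝓝 0) (𝓝 0) :=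
  (Continuous.prodMk_left (0 : E)).tendsto (0 : E)

theorem tendsto_prodMk_zero_left : Tendsto (fun x : E ↦ ((0 : E), x)) (𝓝 0) (𝓝 0) :=
  (Continuous.prodMk_right (0 : E)).tendsto (0 : E)

variable [NormedSpace ℂ E]

/-- The derivative at `0` of `x ↦ (D f (x, 0)) ∘ inr`. -/
theorem hasFDerivAt_fderiv_comp_inr {f : E × E → E} (hf : ContDiffAt ℂ ω f 0) :
    HasFDerivAt (fun x : E ↦ (fderiv ℂ f (x, 0)).comp (ContinuousLinearMap.inr ℂ E E))
      (((ContinuousLinearMap.compL ℂ E (E × E) E).flip (ContinuousLinearMap.inr ℂ E E)).comp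
        ((fderiv ℂ (fderiv ℂ f) 0).comp (ContinuousLinearMap.inl ℂ E E))) 0 := by
  have h1 : HasFDerivAt (fderiv ℂ f) (fderiv ℂ (fderiv ℂ f) 0) (0 : E × E) :=
    ((hf.fderiv_right (m := 1) le_top).differentiableAt (by simp)).hasFDerivAt
  have h2 : HasFDerivAt (fun x : E ↦ fderiv ℂ f (x, 0))
      ((fderiv ℂ (fderiv ℂ f) 0).comp (ContinuousLinearMap.inl ℂ E E)) 0 :=
    HasFDerivAt.comp (g := fderiv ℂ f) (f := fun x : E ↦ (x, (0 : E))) 0 h1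
      (hasFDerivAt_prodMk_left _ _)
  exact ((ContinuousLinearMap.compL ℂ E (E × E) E).flip
    (ContinuousLinearMap.inr ℂ E E)).hasFDerivAt.comp 0 h2

/-- The derivative at `0` of `x ↦ (D f (0, x)) ∘ inl`. -/
theorem hasFDerivAt_fderiv_comp_inl {f : E × E → E} (hf : ContDiffAt ℂ ω f 0) :
    HasFDerivAt (fun x : E ↦ (fderiv ℂ f (0, x)).comp (ContinuousLinearMap.inl ℂ E E))
      (((ContinuousLinearMap.compL ℂ E (E × E) E).flip (ContinuousLinearMap.inl ℂ E E)).comp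
        ((fderiv ℂ (fderiv ℂ f) 0).comp (ContinuousLinearMap.inr ℂ E E))) 0 := by
  have h1 : HasFDerivAt (fderiv ℂ f) (fderiv ℂ (fderiv ℂ f) 0) (0 : E × E) :=
    ((hf.fderiv_right (m := 1) le_top).differentiableAt (by simp)).hasFDerivAt
  have h2 : HasFDerivAt (fun x : E ↦ fderiv ℂ f (0, x))
      ((fderiv ℂ (fderiv ℂ f) 0).comp (ContinuousLinearMap.inr ℂ E E)) 0 :=
    HasFDerivAt.comp (g := fderiv ℂ f) (f := fun x : E ↦ ((0 : E), x)) 0 h1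
      (hasFDerivAt_prodMk_right _ _)
  exact ((ContinuousLinearMap.compL ℂ E (E × E) E).flip
    (ContinuousLinearMap.inl ℂ E E)).hasFDerivAt.comp 0 h2

theorem eventually_differentiableAt {f : E × E → E} (hf : ContDiffAt ℂ ω f 0) :
    ∀ᶠ p in 𝓝 (0 : E × E), DifferentiableAt ℂ f p := by
  filter_upwards [hf.eventually (by simp)] with p hp using hp.differentiableAt (by simp)

end PartialDerivatives

/-! ### The derivative of the adjoint action at the identity. -/

section AdjointDerivative

variable {E : Type*} [NormedAddCommGroup E]
  {G : Type*} [TopologicalSpace G] [ChartedSpace E G] [Group G]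

variable (E G) in
/-- The conjugation in the coordinates at the identity. -/
def conjCoord (p : E × E) : E := coord E (par G p.1 * par G p.2 * (par G p.1)⁻¹)

theorem conjCoord_zero_right (x : E) : conjCoord E G (x, 0) = 0 := by simp [conjCoord]

variable [NormedSpace ℂ E]

variable (E G) in
/-- The mixed second derivative of the multiplication at the identity. -/
def mulHess (v w : E) : E := fderiv ℂ (fderiv ℂ (mulCoord E G)) 0 (v, 0) (0, w)

variable [LieGroup 𝓘(ℂ, E) ω G]

theorem contMDiffAt_par_conj :
    ContMDiffAt 𝓘(ℂ, E × E) 𝓘(ℂ, E) ω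
      (fun p : E × E ↦ par G p.1 * par G p.2 * (par G p.1)⁻¹) 0 := by
  have h1 : ContMDiffAt 𝓘(ℂ, E × E) 𝓘(ℂ, E) ω (fun p : E × E ↦ par G p.1) 0 :=
    contMDiffAt_par_comp contDiffAt_fst rfl
  have h2 : ContMDiffAt 𝓘(ℂ, E × E) 𝓘(ℂ, E) ω (fun p : E × E ↦ par G p.2) 0 :=
    contMDiffAt_par_comp contDiffAt_snd rfl
  exact (h1.mul h2).mul h1.inv

theorem contDiffAt_conjCoord : ContDiffAt ℂ ω (conjCoord E G) 0 :=
  contDiffAt_coord_comp (f := fun p : E × E ↦ par G p.1 * par G p.2 * (par G p.1)⁻¹)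
    contMDiffAt_par_conj (by simp)

theorem eventually_mulCoord_conjCoord :
    ∀ᶠ p in 𝓝 (0 : E × E), mulCoord E G (conjCoord E G p, p.1) = mulCoord E G p := by
  have h := (contMDiffAt_par_conj (E := E) (G := G)).continuousAt.tendsto.eventually
    (by simpa using eventually_par_coord (E := E) (G := G))
  filter_upwards [h] with p hp
  rw [mulCoord, conjCoord, hp, inv_mul_cancel_right, mulCoord]

theorem eventually_adjoint_par : ∀ᶠ x in 𝓝 (0 : E), adjoint (par G x) =
    (fderiv ℂ (conjCoord E G) (x, 0)).comp (ContinuousLinearMap.inr ℂ E E) := by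
  filter_upwards [tendsto_prodMk_zero_right.eventually
    (eventually_differentiableAt (contDiffAt_conjCoord (E := E) (G := G)))] with x hx
  exact (HasFDerivAt.comp (g := conjCoord E G) (f := fun y : E ↦ (x, y)) 0 hx.hasFDerivAt
    (hasFDerivAt_prodMk_right _ _)).fderiv

/-- The identity `(x y x⁻¹) x = x y` differentiated in `y` at the identity: right translation after
`Ad(x)` is left translation. -/
theorem eventually_comp_adjoint_par : ∀ᶠ x in 𝓝 (0 : E),
    ((fderiv ℂ (mulCoord E G) (0, x)).comp (ContinuousLinearMap.inl ℂ E E)).comp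
      (adjoint (par G x)) =
    (fderiv ℂ (mulCoord E G) (x, 0)).comp (ContinuousLinearMap.inr ℂ E E) := by
  have hm := eventually_differentiableAt (contDiffAt_mulCoord (E := E) (G := G))
  have hc := eventually_differentiableAt (contDiffAt_conjCoord (E := E) (G := G))
  filter_upwards [tendsto_prodMk_zero_right.eventually hm,
    tendsto_prodMk_zero_left.eventually hm, tendsto_prodMk_zero_right.eventually hc,
    eventually_adjoint_par (E := E) (G := G),
    (eventually_mulCoord_conjCoord (E := E) (G := G)).curry_nhds] with x h1 h2 h3 h4 h5
  have d1 : HasFDerivAt (fun y ↦ mulCoord E G (x, y))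
      ((fderiv ℂ (mulCoord E G) (x, 0)).comp (ContinuousLinearMap.inr ℂ E E)) 0 :=
    HasFDerivAt.comp (g := mulCoord E G) (f := fun y : E ↦ (x, y)) 0 h1.hasFDerivAt
      (hasFDerivAt_prodMk_right _ _)
  have d2 : HasFDerivAt (fun y ↦ conjCoord E G (x, y)) (adjoint (par G x)) 0 := by
    rw [h4]
    exact HasFDerivAt.comp (g := conjCoord E G) (f := fun y : E ↦ (x, y)) 0 h3.hasFDerivAt
      (hasFDerivAt_prodMk_right _ _)
  have d3 : HasFDerivAt (fun y : E ↦ mulCoord E G (y, x))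
      ((fderiv ℂ (mulCoord E G) (0, x)).comp (ContinuousLinearMap.inl ℂ E E)) 0 :=
    HasFDerivAt.comp (g := mulCoord E G) (f := fun y : E ↦ (y, x)) 0 h2.hasFDerivAt
      (hasFDerivAt_prodMk_left _ _)
  have d4 : HasFDerivAt (fun y ↦ mulCoord E G (conjCoord E G (x, y), x)) _ 0 :=
    HasFDerivAt.comp (g := fun y : E ↦ mulCoord E G (y, x)) (f := fun y ↦ conjCoord E G (x, y)) 0
      (by rw [conjCoord_zero_right]; exact d3) d2
  exact d4.unique (d1.congr_of_eventuallyEq h5)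

theorem adjoint_one : adjoint (1 : G) = ContinuousLinearMap.id ℂ E := by
  refine HasFDerivAt.unique (hasFDerivAt_conj (E := E) (1 : G)) ?_
  refine (hasFDerivAt_id (0 : E)).congr_of_eventuallyEq ?_
  filter_upwards [eventually_coord_par (E := E) (G := G)] with x hx
  simp [hx]

theorem isSymm_mulHess (v w : E) :
    fderiv ℂ (fderiv ℂ (mulCoord E G)) 0 (0, v) (w, 0) = mulHess E G w v :=
  (contDiffAt_mulCoord (E := E) (G := G)).isSymmSndFDerivAt (by simp) (0, v) (w, 0)

/-- The derivative of the adjoint representation. -/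
theorem exists_hasFDerivAt_adjoint_par : ∃ A : E →L[ℂ] E →L[ℂ] E,
    HasFDerivAt (fun x ↦ adjoint (par G x)) A 0 ∧
      ∀ v w, A v w = mulHess E G v w - mulHess E G w v := by
  have hL := hasFDerivAt_fderiv_comp_inr (contDiffAt_mulCoord (E := E) (G := G))
  have hR := hasFDerivAt_fderiv_comp_inl (contDiffAt_mulCoord (E := E) (G := G))
  have hA : HasFDerivAt (fun x ↦ adjoint (par G x)) _ (0 : E) :=
    (hasFDerivAt_fderiv_comp_inr (contDiffAt_conjCoord (E := E) (G := G))).congr_of_eventuallyEq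
      eventually_adjoint_par
  refine ⟨_, hA, fun v w ↦ ?_⟩
  -- Differentiating that identity once more, now in `x` at `0`, and using the symmetry of the
  -- second derivative, isolates the derivative of `Ad`.
  have h := (hR.clm_comp hA).unique (hL.congr_of_eventuallyEq eventually_comp_adjoint_par)
  have h0 : (fderiv ℂ (mulCoord E G) (0, 0)).comp (ContinuousLinearMap.inl ℂ E E) =
      ContinuousLinearMap.id ℂ E := by
    have : ((0 : E), (0 : E)) = 0 := rfl
    rw [this, (hasFDerivAt_mulCoord (E := E) (G := G)).fderiv]
    ext; simp
  rw [h0, par_zero, adjoint_one] at h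
  have h' := congr($h v w)
  simp only [add_apply, ContinuousLinearMap.comp_apply,
    ContinuousLinearMap.compL_apply, ContinuousLinearMap.flip_apply,
    ContinuousLinearMap.id_apply, ContinuousLinearMap.inl_apply,
    ContinuousLinearMap.inr_apply] at h' ⊢
  rw [isSymm_mulHess] at h'
  exact eq_sub_of_add_eq h'

end AdjointDerivative

/-! ### The Lie bracket in coordinates. -/

section Bracket

variable {E : Type*} [NormedAddCommGroup E] [NormedSpace ℂ E]
  {G : Type*} [TopologicalSpace G] [ChartedSpace E G] [Group G] [LieGroup 𝓘(ℂ, E) ω G]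

open VectorField

/-- In coordinates, a left-invariant field is the derivative of the multiplication in its second
variable at `0`. The proof uses that the differentials `A` of `par` and `B` of `coord` are mutually
inverse. -/
theorem eventually_mpullbackWithin_mulInvariantVectorField (X : GroupLieAlgebra 𝓘(ℂ, E) G) :
    ∀ᶠ v in 𝓝 (0 : E), mpullbackWithin 𝓘(ℂ, E) 𝓘(ℂ, E) (extChartAt 𝓘(ℂ, E) (1 : G)).symm
      (mulInvariantVectorField X) (Set.range 𝓘(ℂ, E)) (v + chartAt E (1 : G) (1 : G)) =
      (fderiv ℂ (mulCoord E G) (v, 0)).comp (ContinuousLinearMap.inr ℂ E E) X := by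
  have hm := eventually_differentiableAt (contDiffAt_mulCoord (E := E) (G := G))
  filter_upwards [eventually_add_mem_target (E := E) (G := G),
    eventually_contMDiffAt_par (E := E) (G := G),
    (continuousAt_par (E := E) (G := G)).tendsto.eventually
      (by simpa using eventually_contMDiffAt_coord (E := E) (G := G)),
    (continuousAt_par (E := E) (G := G)).tendsto.eventually
      (p := fun k ↦ ∀ᶠ x in 𝓝 k, par G (coord E x) = x)
      (by simpa using (eventually_par_coord (E := E) (G := G)).eventually_nhds),
    (eventually_coord_par (E := E) (G := G)).eventually_nhds,
    tendsto_prodMk_zero_right.eventually hm] with v ht hpar hcoord hpc hcp hmv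
  obtain ⟨A, hA⟩ : ∃ A : E →L[ℂ] E, HasMFDerivAt 𝓘(ℂ, E) 𝓘(ℂ, E) (par G) v A :=
    ⟨_, (hpar.mdifferentiableAt (by simp)).hasMFDerivAt⟩
  obtain ⟨B, hB⟩ : ∃ B : E →L[ℂ] E, HasMFDerivAt 𝓘(ℂ, E) 𝓘(ℂ, E) (coord E) (par G v) B :=
    ⟨_, (hcoord.mdifferentiableAt (by simp)).hasMFDerivAt⟩
  have hBA : B.comp A = ContinuousLinearMap.id ℂ E :=
    hasMFDerivAt_unique (hB.comp v hA) ((hasMFDerivAt_id v).congr_of_eventuallyEq hcp)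
  have hAB : A.comp B = ContinuousLinearMap.id ℂ E := by
    have hA' : HasMFDerivAt 𝓘(ℂ, E) 𝓘(ℂ, E) (par G) (coord E (par G v)) A := by
      rw [hcp.self_of_nhds]; exact hA
    exact hasMFDerivAt_unique (hA'.comp (par G v) hB)
      ((hasMFDerivAt_id (par G v)).congr_of_eventuallyEq hpc)
  have hmul : (fderiv ℂ (mulCoord E G) (v, 0)).comp (ContinuousLinearMap.inr ℂ E E) =
      B.comp (mulLeftDeriv E (par G v) 1) := by
    have d1 : HasFDerivAt (fun y ↦ mulCoord E G (v, y))
        ((fderiv ℂ (mulCoord E G) (v, 0)).comp (ContinuousLinearMap.inr ℂ E E)) 0 :=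
      HasFDerivAt.comp (g := mulCoord E G) (f := fun y : E ↦ (v, y)) 0 hmv.hasFDerivAt
        (hasFDerivAt_prodMk_right _ _)
    have e1 : HasMFDerivAt 𝓘(ℂ, E) 𝓘(ℂ, E) (fun y : G ↦ par G v * y) (par G (0 : E))
        (mulLeftDeriv E (par G v) 1) := by
      rw [par_zero]; exact hasMFDerivAt_mulLeft _ _
    have e2 : HasMFDerivAt 𝓘(ℂ, E) 𝓘(ℂ, E) (coord E) (par G v * par G (0 : E)) B := by
      rw [par_zero, mul_one]; exact hB
    have e3 : HasFDerivAt (fun y ↦ mulCoord E G (v, y))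
        (B.comp ((mulLeftDeriv E (par G v) 1).comp (ContinuousLinearMap.id ℂ E))) 0 :=
      hasMFDerivAt_iff_hasFDerivAt.1 (e2.comp (0 : E) (e1.comp (0 : E) hasMFDerivAt_par))
    simpa using d1.unique e3
  have hsymm : HasMFDerivAt 𝓘(ℂ, E) 𝓘(ℂ, E) (extChartAt 𝓘(ℂ, E) (1 : G)).symm
      (v + chartAt E (1 : G) (1 : G)) A := by
    have h1 : HasMFDerivAt 𝓘(ℂ, E) 𝓘(ℂ, E) (fun y : E ↦ y - chartAt E (1 : G) (1 : G))
        (v + chartAt E (1 : G) (1 : G)) (ContinuousLinearMap.id ℂ E) :=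
      ((hasFDerivAt_id _).sub_const _).hasMFDerivAt
    have h2 : HasMFDerivAt 𝓘(ℂ, E) 𝓘(ℂ, E) (par G)
        (v + chartAt E (1 : G) (1 : G) - chartAt E (1 : G) (1 : G)) A := by
      rw [add_sub_cancel_right]; exact hA
    have h3 := h2.comp (v + chartAt E (1 : G) (1 : G)) h1
    refine HasMFDerivAt.congr_of_eventuallyEq h3 (Eventually.of_forall fun y ↦ ?_)
    simp [par]
  have hinv : ContinuousLinearMap.inverse A = B := ContinuousLinearMap.inverse_eq hAB hBA
  rw [hmul, mpullbackWithin_apply, ModelWithCorners.range_eq_univ, mfderivWithin_univ]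
  have e := hsymm.mfderiv
  have e' : ((mfderiv 𝓘(ℂ, E) 𝓘(ℂ, E) (extChartAt 𝓘(ℂ, E) (1 : G)).symm
      (v + chartAt E (1 : G) (1 : G)) : E →L[ℂ] E)).inverse = B :=
    (congrArg (fun T : E →L[ℂ] E ↦ T.inverse) e).trans hinv
  exact congrArg (fun T : E →L[ℂ] E ↦ T (mulLeftDeriv E (par G v) 1 X)) e'

/-- The bracket of the Lie algebra in terms of the mixed second derivative of the product. -/
theorem bracket_eq_mulHess (X Y : GroupLieAlgebra 𝓘(ℂ, E) G) :
    (⁅X, Y⁆ : GroupLieAlgebra 𝓘(ℂ, E) G) = mulHess E G X Y - mulHess E G Y X := by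
  set x₀ : E := chartAt E (1 : G) (1 : G) with hx₀
  let L : E → E →L[ℂ] E := fun v ↦
    (fderiv ℂ (mulCoord E G) (v, 0)).comp (ContinuousLinearMap.inr ℂ E E)
  have hL := hasFDerivAt_fderiv_comp_inr (contDiffAt_mulCoord (E := E) (G := G))
  have hL0 : L 0 = ContinuousLinearMap.id ℂ E := by
    have h0 : ((0 : E), (0 : E)) = 0 := rfl
    simp only [L]
    rw [h0, (hasFDerivAt_mulCoord (E := E) (G := G)).fderiv]
    ext; simp
  have ht : Tendsto (fun y : E ↦ y - x₀) (𝓝 x₀) (𝓝 0) := by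
    have : Continuous fun y : E ↦ y - x₀ := by fun_prop
    simpa using this.tendsto x₀
  have hV : ∀ Z : E, mpullbackWithin 𝓘(ℂ, E) 𝓘(ℂ, E) (extChartAt 𝓘(ℂ, E) (1 : G)).symm
      (mulInvariantVectorField (I := 𝓘(ℂ, E)) (G := G) Z) (Set.range 𝓘(ℂ, E)) =ᶠ[𝓝 x₀]
        fun y : E ↦ L (y - x₀) Z := fun Z ↦ by
    filter_upwards [ht.eventually (eventually_mpullbackWithin_mulInvariantVectorField
      (E := E) (G := G) Z)] with y hy
    rw [sub_add_cancel] at hy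
    exact hy
  have hd : ∀ Z : E, HasFDerivAt (fun y : E ↦ L (y - x₀) Z)
      ((fderiv ℂ (fderiv ℂ (mulCoord E G)) 0).comp (ContinuousLinearMap.inl ℂ E E)|>.flip
        ((0 : E), Z)) x₀ := fun Z ↦ by
    have h1 : HasFDerivAt (fun y : E ↦ L (y - x₀)) _ x₀ :=
      HasFDerivAt.comp (g := L) (f := fun y : E ↦ y - x₀) x₀ (by rw [sub_self]; exact hL)
        ((hasFDerivAt_id x₀).sub_const x₀)
    convert! h1.clm_apply (hasFDerivAt_const Z x₀) using 1
    ext v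
    simp
  have hbr : lieBracket ℂ (fun y : E ↦ L (y - x₀) X) (fun y : E ↦ L (y - x₀) Y) x₀ =
      mulHess E G X Y - mulHess E G Y X := by
    rw [lieBracket_eq]
    simp only [(hd X).fderiv, (hd Y).fderiv, sub_self, hL0]
    rfl
  have hchart : HasMFDerivAt 𝓘(ℂ, E) 𝓘(ℂ, E) (extChartAt 𝓘(ℂ, E) (1 : G)) (1 : G)
      (ContinuousLinearMap.id ℂ E) := by
    have h1 : HasMFDerivAt 𝓘(ℂ, E) 𝓘(ℂ, E) (fun y : E ↦ y + x₀) (coord E (1 : G))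
        (ContinuousLinearMap.id ℂ E) := ((hasFDerivAt_id _).add_const _).hasMFDerivAt
    refine HasMFDerivAt.congr_of_eventuallyEq (h1.comp (1 : G) hasMFDerivAt_coord)
      (Eventually.of_forall fun y ↦ ?_)
    simp [coord, hx₀]
  have hinv : ((mfderiv 𝓘(ℂ, E) 𝓘(ℂ, E) (extChartAt 𝓘(ℂ, E) (1 : G)) (1 : G) :
      E →L[ℂ] E)).inverse = ContinuousLinearMap.id ℂ E :=
    (congrArg (fun T : E →L[ℂ] E ↦ T.inverse) hchart.mfderiv).trans
      ContinuousLinearMap.inverse_id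
  have hb2 : ∀ V W : E → E, V =ᶠ[𝓝 x₀] (fun y ↦ L (y - x₀) X) →
      W =ᶠ[𝓝 x₀] (fun y ↦ L (y - x₀) Y) → lieBracketWithin ℂ V W
      ((extChartAt 𝓘(ℂ, E) (1 : G)).symm ⁻¹' Set.univ ∩ Set.range 𝓘(ℂ, E)) x₀ =
      mulHess E G X Y - mulHess E G Y X := by
    intro V W hV hW
    rw [Set.preimage_univ, Set.univ_inter, ModelWithCorners.range_eq_univ,
      lieBracketWithin_univ, hV.lieBracket_vectorField_eq hW]
    exact hbr
  rw [GroupLieAlgebra.bracket_def, ← mlieBracketWithin_univ, mlieBracketWithin_apply]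
  exact (congrArg (fun T : E →L[ℂ] E ↦ T _) hinv).trans (hb2 _ _ (hV X) (hV Y))

end Bracket

/-! ### Comparison of the Hermitian norm with the norm of the model space. -/

section Seminorms

theorem _root_.InnerProductSpace.Core.exists_seminorm {V : Type*} [AddCommGroup V] [Module ℂ V]
    (c : InnerProductSpace.Core ℂ V) :
    ∃ p : Seminorm ℂ V, (∀ x, p x = √(c.inner x x).re) ∧ ∀ x, p x = 0 → x = 0 := by
  let := c
  let : NormedAddCommGroup V := InnerProductSpace.Core.toNormedAddCommGroup (𝕜 := ℂ)
  let : NormedSpace ℂ V := InnerProductSpace.Core.toNormedSpace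
  exact ⟨normSeminorm ℂ V, fun x ↦ rfl, fun x hx ↦ norm_eq_zero.1 hx⟩

variable {E : Type*} [NormedAddCommGroup E] [NormedSpace ℂ E] [FiniteDimensional ℂ E]

theorem exists_le_norm_of_seminorm (p : Seminorm ℂ E) : ∃ K > 0, ∀ x, p x ≤ K * ‖x‖ := by
  let b := Module.finBasis ℂ E
  refine ⟨1 + ∑ i, ‖(b.coord i).toContinuousLinearMap‖ * p (b i), ?_, fun x ↦ ?_⟩
  · have : 0 ≤ ∑ i, ‖(b.coord i).toContinuousLinearMap‖ * p (b i) := by positivity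
    linarith
  calc p x = p (∑ i, b.repr x i • b i) := by rw [b.sum_repr]
    _ ≤ ∑ i, p (b.repr x i • b i) :=
      Finset.le_sum_of_subadditive p (map_zero p).le (map_add_le_add p) _ _
    _ ≤ ∑ i, ‖(b.coord i).toContinuousLinearMap‖ * p (b i) * ‖x‖ := by
      refine Finset.sum_le_sum fun i _ ↦ ?_
      rw [map_smul_eq_mul, mul_right_comm]
      gcongr
      exact (b.coord i).toContinuousLinearMap.le_opNorm x
    _ ≤ _ := by
      rw [← Finset.sum_mul, add_mul, one_mul]
      linarith [norm_nonneg x]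

theorem continuous_seminorm (p : Seminorm ℂ E) : Continuous p := by
  obtain ⟨K, _, hK⟩ := exists_le_norm_of_seminorm p
  refine Seminorm.continuous_of_continuousAt_zero ?_
  rw [ContinuousAt, map_zero]
  refine squeeze_zero (fun x ↦ apply_nonneg p x) hK ?_
  have : Continuous fun x : E ↦ K * ‖x‖ := by fun_prop
  simpa using this.tendsto 0

/-- `p` has a positive minimum on the compact unit sphere. The comparison turns limits in operator
norm into estimates in `p`, in which the sharp constants are measured. -/
theorem exists_norm_le_of_seminorm (p : Seminorm ℂ E) (hp : ∀ x, p x = 0 → x = 0) :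
    ∃ K > 0, ∀ x, ‖x‖ ≤ K * p x := by
  have : ProperSpace E := FiniteDimensional.proper ℂ E
  have hc : Continuous p := continuous_seminorm p
  obtain hE | hE := subsingleton_or_nontrivial E
  · exact ⟨1, one_pos, fun x ↦ by simp [Subsingleton.elim x 0]⟩
  obtain ⟨x₀, hx₀, hmin⟩ := (isCompact_sphere (0 : E) 1).exists_isMinOn
    (NormedSpace.sphere_nonempty.2 zero_le_one) hc.continuousOn
  have hx₀' : x₀ ≠ 0 := by rintro rfl; simp at hx₀
  have hpos : 0 < p x₀ := (apply_nonneg p x₀).lt_of_ne fun h ↦ hx₀' (hp _ h.symm)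
  refine ⟨(p x₀)⁻¹, inv_pos.2 hpos, fun x ↦ ?_⟩
  obtain rfl | hx := eq_or_ne x 0
  · simp
  have hn : 0 < ‖x‖ := norm_pos_iff.2 hx
  have h1 : p x₀ ≤ p (((‖x‖⁻¹ : ℝ) : ℂ) • x) := hmin (by simp [norm_smul, hx])
  rw [map_smul_eq_mul] at h1
  simp only [Complex.norm_real, norm_inv, norm_norm] at h1
  rw [inv_mul_eq_div, le_div_iff₀ hn] at h1
  rw [inv_mul_eq_div, le_div_iff₀ hpos]
  linarith

/-- Continuous linear maps are bounded with respect to a definite seminorm. -/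
theorem exists_seminorm_clm_le (p : Seminorm ℂ E) (hp : ∀ x, p x = 0 → x = 0) :
    ∃ K > 0, ∀ (R : E →L[ℂ] E) (w : E), p (R w) ≤ K * ‖R‖ * p w := by
  obtain ⟨K₁, h₁, hK₁⟩ := exists_le_norm_of_seminorm p
  obtain ⟨K₂, h₂, hK₂⟩ := exists_norm_le_of_seminorm p hp
  refine ⟨K₁ * K₂, by positivity, fun R w ↦ ?_⟩
  calc p (R w) ≤ K₁ * ‖R w‖ := hK₁ _
    _ ≤ K₁ * (‖R‖ * (K₂ * p w)) := by
      gcongr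
      exact (R.le_opNorm w).trans (by gcongr; exact hK₂ w)
    _ = _ := by ring

end Seminorms

/-! ### The function `(e^t - 1)/t` and geometric sums. -/

section ExpQuotient

theorem continuous_expQuotient : Continuous expQuotient := by
  have h : expQuotient = dslope Real.exp 0 := by
    ext t
    obtain rfl | ht := eq_or_ne t 0
    · simp [expQuotient]
    · simp [expQuotient, ht, dslope_of_ne, slope_def_field]
  rw [h, continuous_iff_continuousAt]
  intro t
  obtain rfl | ht := eq_or_ne t 0
  · exact continuousAt_dslope_same.2 Real.differentiable_exp.differentiableAt
  · exact (continuousAt_dslope_of_ne ht).2 Real.continuous_exp.continuousAt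

theorem expQuotient_nonneg {t : ℝ} (ht : 0 ≤ t) : 0 ≤ expQuotient t := by
  rw [expQuotient]
  split_ifs
  · exact zero_le_one
  · exact div_nonneg (by linarith [Real.one_le_exp ht]) ht

/-- The geometric sum with ratio `1 + κ / n`. -/
theorem geom_sum_le_expQuotient {κ : ℝ} (hκ : 0 < κ) {n : ℕ} (hn : n ≠ 0) :
    ∑ k ∈ Finset.range n, (1 + κ / n) ^ k ≤ n * expQuotient κ := by
  have hn' : (0 : ℝ) < n := by positivity
  have h1 : (1 + κ / n : ℝ) ≠ 1 := by
    have : 0 < κ / n := by positivity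
    linarith
  have h2 : (1 + κ / n : ℝ) ^ n ≤ Real.exp κ := by
    calc (1 + κ / n : ℝ) ^ n ≤ Real.exp (κ / n) ^ n := by
          gcongr
          linarith [Real.add_one_le_exp (κ / n)]
      _ = Real.exp κ := by rw [← Real.exp_nat_mul]; congr 1; field_simp
  have h3 : n * ((Real.exp κ - 1) / κ) * (κ / n) = Real.exp κ - 1 := by field_simp
  rw [geom_sum_eq h1, expQuotient, if_neg hκ.ne', add_sub_cancel_left, div_le_iff₀ (by positivity),
    h3]
  linarith

end ExpQuotient

/-! ### The estimate of the derivative of the exponential map. -/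

section Bound

variable {E : Type*} [NormedAddCommGroup E] [NormedSpace ℂ E]
  {G : Type*} [TopologicalSpace G] [ChartedSpace E G] [Group G] [LieGroup 𝓘(ℂ, E) ω G]

section

variable [CompleteSpace E]

theorem natCast_smul_leftDeriv_lieExp (n : ℕ) (y : E) :
    leftDeriv (E := E) (fun x ↦ lieExp E G x ^ n) y =
      (n : ℂ) • leftDeriv (E := E) (lieExp E G) ((n : ℂ) • y) := by
  have h : (fun x ↦ lieExp E G x ^ n) =
      fun x ↦ lieExp E G (((n : ℂ) • ContinuousLinearMap.id ℂ E) x) := by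
    ext x; simp [lieExp_nat_smul]
  rw [h, leftDeriv_comp_clm _ (mdifferentiableAt_lieExp _)]
  ext v
  simp

theorem mdifferentiableAt_lieExp_pow (n : ℕ) (y : E) :
    MDifferentiableAt 𝓘(ℂ, E) 𝓘(ℂ, E) (fun x ↦ lieExp E G x ^ n) y :=
  ((contMDiff_pow (I := 𝓘(ℂ, E)) (n := ω) (G := G) n).contMDiffAt.mdifferentiableAt
    (by simp)).comp y (mdifferentiableAt_lieExp y)

/-- The estimate for the powers of the exponential map. -/
theorem seminorm_leftDeriv_lieExp_pow_le (p : Seminorm ℂ E) (y : E) {α β : ℝ} (hα : 0 ≤ α)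
    (hA : ∀ w, p (adjoint (lieExp E G y)⁻¹ w) ≤ α * p w)
    (hD : ∀ w, p (leftDeriv (lieExp E G) y w) ≤ β * p w) (n : ℕ) (w : E) :
    p (leftDeriv (fun x ↦ lieExp E G x ^ n) y w) ≤
      (∑ k ∈ Finset.range n, α ^ k) * (β * p w) := by
  induction n with
  | zero => rw [natCast_smul_leftDeriv_lieExp]; simp
  | succ n ih =>
    have h := leftDeriv_mul (mdifferentiableAt_lieExp_pow (G := G) n y)
      (mdifferentiableAt_lieExp (G := G) y)
    simp only [← pow_succ] at h
    rw [h, add_apply, ContinuousLinearMap.comp_apply, geom_sum_succ]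
    calc _ ≤ _ := map_add_le_add p _ _
      _ ≤ α * ((∑ k ∈ Finset.range n, α ^ k) * (β * p w)) + β * p w := by
        gcongr
        · exact (hA _).trans (by gcongr)
        · exact hD w
      _ = _ := by ring

/-- The base point of the left derivative moves with `y`, so it is taken as a separate variable: the
left derivative is the second partial derivative, on the diagonal, of the `C¹` map `Q`. -/
theorem continuousAt_leftDeriv_lieExp :
    ContinuousAt (fun y : E ↦ leftDeriv (E := E) (lieExp E G) y) 0 := by
  obtain ⟨e, hec, he0, hed, he⟩ := lieExp_eventually_eq_par (E := E) (G := G)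
  set Q : E × E → E := fun q ↦ coord E ((par G (e q.1))⁻¹ * par G (e q.2)) with hQ
  have hQc : ContDiffAt ℂ 1 Q 0 := by
    refine contDiffAt_coord_comp (f := fun q : E × E ↦ (par G (e q.1))⁻¹ * par G (e q.2)) ?_
      (by simp)
    have h1 : ContMDiffAt 𝓘(ℂ, E × E) 𝓘(ℂ, E) 1 (fun q : E × E ↦ par G (e q.1)) 0 :=
      contMDiffAt_par_comp (f := fun q : E × E ↦ e q.1)
        (ContDiffAt.comp (g := e) (0 : E × E) hec contDiffAt_fst) (by simpa using he0)
    have h2 : ContMDiffAt 𝓘(ℂ, E × E) 𝓘(ℂ, E) 1 (fun q : E × E ↦ par G (e q.2)) 0 :=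
      contMDiffAt_par_comp (f := fun q : E × E ↦ e q.2)
        (ContDiffAt.comp (g := e) (0 : E × E) hec contDiffAt_snd) (by simpa using he0)
    have : LieGroup 𝓘(ℂ, E) 1 G := LieGroup.of_le (n := ω) le_top
    exact h1.inv.mul h2
  have hdiag : Tendsto (fun y : E ↦ (y, y)) (𝓝 0) (𝓝 0) :=
    (continuous_id.prodMk continuous_id).tendsto (0 : E)
  have hev : ∀ᶠ y in 𝓝 (0 : E), leftDeriv (lieExp E G) y =
      (fderiv ℂ Q (y, y)).comp (ContinuousLinearMap.inr ℂ E E) := by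
    filter_upwards [he.eventually_nhds, hdiag.eventually (hQc.eventually (by simp))] with y h1 h2
    have h3 : HasFDerivAt (fun x ↦ Q (y, x))
        ((fderiv ℂ Q (y, y)).comp (ContinuousLinearMap.inr ℂ E E)) y :=
      HasFDerivAt.comp (g := Q) (f := fun x : E ↦ (y, x)) y
        (h2.differentiableAt (by simp)).hasFDerivAt (hasFDerivAt_prodMk_right _ _)
    refine (h3.congr_of_eventuallyEq ?_).fderiv
    filter_upwards [h1] with x hx
    rw [hx, h1.self_of_nhds]
  have hcont : ContinuousAt (fun y : E ↦ (fderiv ℂ Q (y, y)).comp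
      (ContinuousLinearMap.inr ℂ E E)) 0 := by
    have h1 : ContinuousAt (fderiv ℂ Q) 0 := (hQc.fderiv_right (m := 0) (by simp)).continuousAt
    have h2 : ContinuousAt (fun y : E ↦ fderiv ℂ Q (y, y)) 0 :=
      ContinuousAt.comp (g := fderiv ℂ Q) (f := fun y : E ↦ (y, y)) h1
        (continuous_id.prodMk continuous_id).continuousAt
    exact h2.clm_comp continuousAt_const
  exact hcont.congr (hev.mono fun _ h ↦ h.symm)

theorem hasFDerivAt_adjoint_lieExp {A : E →L[ℂ] E →L[ℂ] E}
    (hA : HasFDerivAt (fun x ↦ adjoint (par G x)) A 0) :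
    HasFDerivAt (fun x ↦ adjoint (lieExp E G x)) A 0 := by
  have h1 : HasFDerivAt (fun x ↦ adjoint (par G (coord E (lieExp E G x))))
      (A.comp (ContinuousLinearMap.id ℂ E)) 0 :=
    HasFDerivAt.comp (g := fun x ↦ adjoint (par G x)) (f := fun x ↦ coord E (lieExp E G x)) 0
      (by simpa using hA) hasFDerivAt_coord_lieExp
  have hc : Tendsto (lieExp E G) (𝓝 0) (𝓝 1) := by
    simpa using (mdifferentiableAt_lieExp (G := G) (0 : E)).continuousAt.tendsto
  refine h1.congr_of_eventuallyEq ?_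
  filter_upwards [hc.eventually (eventually_par_coord (E := E))] with x hx
  rw [hx]

end

variable [FiniteDimensional ℂ E]

/-- First-order expansion: `Ad(Exp(-x/n)) = 1 - A(x)/n + o(1/n)`, with `δ` absorbing the remainder.
-/
theorem eventually_seminorm_adjoint_le [CompleteSpace E] {p : Seminorm ℂ E}
    (hp : ∀ x, p x = 0 → x = 0)
    {A : E →L[ℂ] E →L[ℂ] E} (hA : HasFDerivAt (fun x ↦ adjoint (par G x)) A 0) {x : E} {c δ : ℝ}
    (hc : ∀ w, p (A x w) ≤ c * p w) (hδ : 0 < δ) :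
    ∀ᶠ n : ℕ in atTop, ∀ w,
      p (adjoint (lieExp E G ((n : ℂ)⁻¹ • x))⁻¹ w) ≤ (1 + (c + δ) / n) * p w := by
  obtain ⟨K, hK, hKR⟩ := exists_seminorm_clm_le p hp
  have hlim := (hasFDerivAt_adjoint_lieExp hA).lim (-x) tendsto_norm_natCast_atTop
  have hev : ∀ᶠ n : ℕ in atTop, ‖(n : ℂ) • (adjoint (lieExp E G (0 + (n : ℂ)⁻¹ • (-x))) -
      adjoint (lieExp E G 0)) - A (-x)‖ < δ / K := by
    have := (hlim.sub_const (A (-x))).norm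
    rw [sub_self, norm_zero] at this
    exact this.eventually (gt_mem_nhds (by positivity))
  filter_upwards [hev, eventually_ne_atTop 0] with n hn hn0 w
  have hn' : (n : ℂ) ≠ 0 := by exact_mod_cast hn0
  have hn'' : (0 : ℝ) < n := by positivity
  rw [zero_add, lieExp_zero, adjoint_one, smul_neg, lieExp_neg] at hn
  set T := adjoint (E := E) (lieExp E G ((n : ℂ)⁻¹ • x))⁻¹ with hT
  set R : E →L[ℂ] E := (n : ℂ) • (T - ContinuousLinearMap.id ℂ E) - A (-x) with hR
  have hw : T w = w + (n : ℂ)⁻¹ • (R w + A (-x) w) := by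
    simp [hR, hn']
  have h1 : p (A (-x) w) ≤ c * p w := by
    rw [map_neg, neg_apply, map_neg_eq_map]; exact hc w
  have h2 : p (R w) ≤ δ * p w := by
    refine (hKR R w).trans ?_
    gcongr
    rw [lt_div_iff₀ hK] at hn
    linarith
  calc p (T w) ≤ p w + p ((n : ℂ)⁻¹ • (R w + A (-x) w)) := by rw [hw]; exact map_add_le_add p _ _
    _ = p w + (n : ℝ)⁻¹ * p (R w + A (-x) w) := by rw [map_smul_eq_mul]; simp
    _ ≤ p w + (n : ℝ)⁻¹ * (δ * p w + c * p w) := by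
      gcongr
      exact (map_add_le_add p _ _).trans (add_le_add h2 h1)
    _ = _ := by field_simp; ring

theorem eventually_seminorm_leftDeriv_le [CompleteSpace E] {p : Seminorm ℂ E}
    (hp : ∀ x, p x = 0 → x = 0) (x : E) {δ : ℝ} (hδ : 0 < δ) :
    ∀ᶠ n : ℕ in atTop, ∀ w,
      p (leftDeriv (lieExp E G) ((n : ℂ)⁻¹ • x) w) ≤ (1 + δ) * p w := by
  obtain ⟨K, hK, hKR⟩ := exists_seminorm_clm_le p hp
  have hlim : Tendsto (fun n : ℕ ↦ leftDeriv (E := E) (lieExp E G) ((n : ℂ)⁻¹ • x)) atTop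
      (𝓝 (ContinuousLinearMap.id ℂ E)) := by
    have := (continuousAt_leftDeriv_lieExp (E := E) (G := G)).tendsto.comp
      (tendsto_natCast_inv_smul x)
    rwa [leftDeriv_lieExp_zero] at this
  have hev : ∀ᶠ n : ℕ in atTop, ‖leftDeriv (E := E) (lieExp E G) ((n : ℂ)⁻¹ • x) -
      ContinuousLinearMap.id ℂ E‖ < δ / K := by
    have := (hlim.sub_const (ContinuousLinearMap.id ℂ E)).norm
    rw [sub_self, norm_zero] at this
    exact this.eventually (gt_mem_nhds (by positivity))
  filter_upwards [hev] with n hn w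
  set T := leftDeriv (E := E) (lieExp E G) ((n : ℂ)⁻¹ • x)
  have hw : T w = w + (T - ContinuousLinearMap.id ℂ E) w := by simp
  rw [hw, add_mul, one_mul]
  refine (map_add_le_add p _ _).trans ?_
  gcongr
  refine (hKR _ w).trans ?_
  gcongr
  rw [lt_div_iff₀ hK] at hn
  linarith

/-- The estimate of the left derivative of the exponential map. -/
theorem seminorm_leftDeriv_lieExp_le [CompleteSpace E] {p : Seminorm ℂ E}
    (hp : ∀ x, p x = 0 → x = 0)
    {A : E →L[ℂ] E →L[ℂ] E} (hA : HasFDerivAt (fun x ↦ adjoint (par G x)) A 0) {x : E} {c : ℝ}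
    (hc0 : 0 ≤ c) (hc : ∀ w, p (A x w) ≤ c * p w) (w : E) :
    p (leftDeriv (lieExp E G) x w) ≤ expQuotient c * p w := by
  -- A positive `δ` also keeps the ratio of the geometric sum different from `1` when `c = 0`.
  have key : ∀ δ > 0, p (leftDeriv (lieExp E G) x w) ≤
      expQuotient (c + δ) * ((1 + δ) * p w) := by
    intro δ hδ
    obtain ⟨n, ⟨h1, h2⟩, hn⟩ := (((eventually_seminorm_adjoint_le hp hA hc hδ).and
      (eventually_seminorm_leftDeriv_le (G := G) hp x hδ)).and (eventually_ne_atTop 0)).exists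
    have hn' : (n : ℂ) ≠ 0 := by exact_mod_cast hn
    have hn'' : (0 : ℝ) < n := by positivity
    have h3 := seminorm_leftDeriv_lieExp_pow_le p ((n : ℂ)⁻¹ • x) (by positivity) h1 h2 n w
    rw [natCast_smul_leftDeriv_lieExp, smul_inv_smul₀ hn', smul_apply, map_smul_eq_mul,
      Complex.norm_natCast] at h3
    have h4 : (n : ℝ) * p (leftDeriv (lieExp E G) x w) ≤
        n * (expQuotient (c + δ) * ((1 + δ) * p w)) := by
      rw [← mul_assoc]
      refine h3.trans ?_
      gcongr
      exact geom_sum_le_expQuotient (by positivity) hn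
    exact le_of_mul_le_mul_left h4 hn''
  have hlim : Tendsto (fun δ : ℝ ↦ expQuotient (c + δ) * ((1 + δ) * p w)) (𝓝[>] 0)
      (𝓝 (expQuotient c * p w)) := by
    have h : Continuous fun δ : ℝ ↦ expQuotient (c + δ) * ((1 + δ) * p w) := by
      have := continuous_expQuotient.comp (continuous_const_add c)
      exact this.mul (by fun_prop)
    simpa using (h.tendsto 0).mono_left nhdsWithin_le_nhds
  exact ge_of_tendsto hlim (eventually_mem_nhdsWithin.mono fun δ hδ ↦ key δ hδ)

end Bound

/-! ### The Hermitian metric and the structure constant. -/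

section Metric

variable {E : Type*} [NormedAddCommGroup E] [NormedSpace ℂ E]
  {G : Type*} [TopologicalSpace G] [ChartedSpace E G]

namespace HermitianMetric

theorem exists_seminorm (h : HermitianMetric E G) (g : G) :
    ∃ p : Seminorm ℂ E, (∀ x : E, p x = h.norm g x) ∧ ∀ x, p x = 0 → x = 0 :=
  (h.core g).exists_seminorm

variable [Group G] {h : HermitianMetric E G}

theorem IsLeftInvariant.norm_mulLeftDeriv (hinv : h.IsLeftInvariant) {a k b : G}
    (hb : a * k = b) (v : E) : h.norm b (mulLeftDeriv E a k v) = h.norm k v := by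
  subst hb
  exact congrArg (fun z : ℂ ↦ √z.re) (hinv a k v v)

theorem structureConstant_nonneg (h : HermitianMetric E G) : 0 ≤ h.structureConstant := by
  refine Real.sSup_nonneg ?_
  rintro _ ⟨X, Y, -, -, rfl⟩
  exact Real.sqrt_nonneg _

theorem seminorm_le_structureConstant_mul [LieGroup 𝓘(ℂ, E) ω G] [FiniteDimensional ℂ E]
    {p : Seminorm ℂ E} (hp : ∀ x, p x = 0 → x = 0)
    (hph : ∀ x : E, p x = h.norm 1 x) {A : E →L[ℂ] E →L[ℂ] E}
    (hA : ∀ v w, A v w = mulHess E G v w - mulHess E G w v) (v w : E) :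
    p (A v w) ≤ h.structureConstant * p v * p w := by
  have hbr : ∀ X Y : GroupLieAlgebra 𝓘(ℂ, E) G, h.norm 1 ⁅X, Y⁆ = p (A X Y) := by
    intro X Y
    rw [hph]
    exact congrArg (h.norm 1) ((bracket_eq_mulHess X Y).trans (hA X Y).symm)
  -- Boundedness is what makes the real supremum an upper bound: `sSup` of an unbounded set is `0`.
  have hbdd : BddAbove {r : ℝ | ∃ X Y : GroupLieAlgebra 𝓘(ℂ, E) G,
      h.norm 1 X = 1 ∧ h.norm 1 Y = 1 ∧ r = h.norm 1 ⁅X, Y⁆} := by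
    obtain ⟨K₁, h₁, hK₁⟩ := exists_seminorm_clm_le p hp
    obtain ⟨K₂, h₂, hK₂⟩ := exists_norm_le_of_seminorm p hp
    refine ⟨K₁ * (‖A‖ * K₂), ?_⟩
    rintro _ ⟨X, Y, hX, hY, rfl⟩
    rw [hbr]
    have hX' : p X = 1 := (hph X).trans hX
    have hY' : p Y = 1 := (hph Y).trans hY
    have h3 := hK₁ (A X) Y
    rw [hY', mul_one] at h3
    refine h3.trans ?_
    gcongr
    refine (A.le_opNorm X).trans ?_
    gcongr
    simpa [hX'] using hK₂ X
  obtain hv | hv := eq_or_ne (p v) 0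
  · simp [hp v hv]
  obtain hw | hw := eq_or_ne (p w) 0
  · simp [hp w hw]
  have hunit : ∀ u : E, p u ≠ 0 → p (((p u)⁻¹ : ℂ) • u) = 1 := by
    intro u hu
    rw [map_smul_eq_mul]
    simp [abs_of_nonneg (apply_nonneg p u), hu]
  have hle : p (A (((p v)⁻¹ : ℂ) • v) (((p w)⁻¹ : ℂ) • w)) ≤ h.structureConstant :=
    le_csSup hbdd ⟨_, _, (hph _).symm.trans (hunit v hv), (hph _).symm.trans (hunit w hw),
      (hbr _ _).symm⟩
  have hv' : 0 < p v := (apply_nonneg p v).lt_of_ne hv.symm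
  have hw' : 0 < p w := (apply_nonneg p w).lt_of_ne hw.symm
  rw [A.map_smul, smul_apply, ContinuousLinearMap.map_smul, map_smul_eq_mul,
    map_smul_eq_mul] at hle
  simp only [norm_inv, Complex.norm_real, Real.norm_eq_abs, abs_of_pos hv', abs_of_pos hw'] at hle
  rw [inv_mul_eq_div, inv_mul_eq_div, div_div, div_le_iff₀ (by positivity)] at hle
  linarith

end HermitianMetric

end Metric

end ComplexLieGroup

end

/-! ### The main theorem. -/

theorem mainTheorem4 {E : Type*} [NormedAddCommGroup E] [NormedSpace ℂ E]
    [FiniteDimensional ℂ E] {G : Type*} [TopologicalSpace G] [ChartedSpace E G] [Group G]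
    [LieGroup 𝓘(ℂ, E) ω G]
    (h : ComplexLieGroup.HermitianMetric E G) (hinv : h.IsLeftInvariant)
    (g : G) (ξ : TangentSpace 𝓘(ℂ, E) g) :
    (∃! γ : ℂ → G, ComplexLieGroup.IsExpCurve g ξ γ) ∧
    MDifferentiableAt 𝓘(ℂ, E) 𝓘(ℂ, E) (ComplexLieGroup.expMap E g) ξ ∧
    h.opNorm g (ComplexLieGroup.expAt g ξ) (ComplexLieGroup.dexpAt g ξ) ≤
      ComplexLieGroup.expQuotient (h.structureConstant * h.norm g ξ) := by
  open ComplexLieGroup in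
  have : CompleteSpace E := FiniteDimensional.complete ℂ E
  refine ⟨existsUnique_isExpCurve g ξ, mdifferentiableAt_expMap (E := E) g ξ, ?_⟩
  obtain ⟨p, hph, hp⟩ := h.exists_seminorm 1
  obtain ⟨A, hA, hAm⟩ := exists_hasFDerivAt_adjoint_par (E := E) (G := G)
  have hT : ∀ η : E, p (mulLeftDeriv E g⁻¹ g η : E) = h.norm g η := fun η ↦
    (hph _).trans (hinv.norm_mulLeftDeriv (inv_mul_cancel g) η)
  have hC := h.structureConstant_nonneg
  have hnn : 0 ≤ h.structureConstant * h.norm g ξ := mul_nonneg hC (Real.sqrt_nonneg _)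
  refine Real.iSup_le (fun η ↦ ?_) (expQuotient_nonneg hnn)
  -- This form needs only a nonnegative denominator, so `η = 0` is covered.
  refine div_le_of_le_mul₀ (Real.sqrt_nonneg _) (expQuotient_nonneg hnn) ?_
  -- The outer left translation is an isometry and drops out; `hT` does the same for the inner one.
  have h1 : h.norm (expAt g ξ) (dexpAt g ξ η) =
      p (leftDeriv (E := E) (F := E) (lieExp E G) (mulLeftDeriv E g⁻¹ g ξ)
        (mulLeftDeriv E g⁻¹ g η)) := by
    rw [hph]
    exact (congrArg (h.norm (expAt g ξ)) (dexpAt_apply (E := E) g ξ η)).trans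
      (hinv.norm_mulLeftDeriv (mul_one _) _)
  have h2 : ∀ w, p (A (mulLeftDeriv E g⁻¹ g ξ) w) ≤ h.structureConstant * h.norm g ξ * p w := by
    intro w
    rw [← hT ξ]
    exact HermitianMetric.seminorm_le_structureConstant_mul hp hph hAm _ w
  rw [h1, ← hT η]
  exact seminorm_leftDeriv_lieExp_le hp hA hnn h2 _
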